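/- Let $N\ge 3$ and $k\ge 2$ be integers. For $0<\rho<1$ let $\Omega_\rho=\{x\in\mathbb R^N:\rho<|x|<1\}$, let $\omega_{N-1}$ be the surface measure of the unit sphere of $\mathbb R^N$, and let $G_\rho$ be the Green function of $-\Delta$ in $\Omega_\rho$ with zero Dirichlet boundary condition, that is, $$G_\rho(x,y)=\frac{1}{\omega_{N-1}(N-2)\,|x-y|^{N-2}}-H_\rho(x,y),$$ where, for each $y\in\Omega_\rho$, the function $H_\rho(\cdot,y)$ is harmonic in $\Omega_\rho$, continuous on $\overline{\Omega_\rho}$, and equal to $\frac{1}{\omega_{N-1}(N-2)}|x-y|^{2-N}$ for $x\in\partial\Omega_\rho$. Let $\tau_\rho(x)=H_\rho(x,x)$ be the Robin function. For $r\in(\rho,1)$ put $$\xi_j(r)=\Big(r\cos\tfrac{2\pi (j-1)}{k},\,r\sin\tfrac{2\pi (j-1)}{k},\,0,\dots,0\Big)\in\mathbb R^N,\qquad j=1,\dots,k,$$ and let $\Lambda_1(r)=\Lambda_{1}(\rho,r)$ be the least eigenvalue of the symmetric $k\times k$ matrix with diagonal entries $\tau_\rho(\xi_i(r))$ and off-diagonal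 entries $-G_\rho(\xi_i(r),\xi_j(r))$, $i\ne j$. For $\lambda>0$ let $C_m^\lambda$ be the Gegenbauer polynomials, $(1-2st+s^2)^{-\lambda}=\sum_{m\ge 0}C_m^\lambda(t)s^m$, and put $$\alpha_{k,m,N}=\binom{N+m-3}{N-3}+\sum_{j=1}^{k-1}C_m^{\frac{N-2}{2}}\Big(\cos\tfrac{2\pi j}{k}\Big),\qquad \mathfrak C_{k,N}=\sum_{j=1}^{k-1}\frac{1}{\big(2\sin\frac{\pi j}{k}\big)^{N-2}}.$$ Then: 1. For every $\rho\in(0,1)$ the minimum $\mathfrak m(\rho)=\min_{r\in(\rho,1)}\Lambda_1(r)$ is attained. 2. The function $\mathfrak m:(0,1)\to\mathbb R$ has exactly one zero $\rho_k\in(0,1)$; moreover $\mathfrak m(\rho)>0$ for $\rho\in(\rho_k,1)$ and $\mathfrak m(\rho)<0$ for $\rho\in(0,\rho_k)$. 3. For every $\rho\in(0,1)$ the series $$h(\rho)=\sum_{m=0}^{\infty}\alpha_{k,m,N}\,\frac{2\rho^{\frac{2m+N-2}{2}}}{1+\rho^{\frac{2m+N-2}{2}}}-\mathfrak C_{k,N}$$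 converges, and the minimum of $r^{N-2}\Lambda_1(r)$ over $r\in(\rho,1)$ is attained and equals $\dfrac{h(\rho)}{\omega_{N-1}(N-2)}$. 4. The function $h$ is strictly increasing on $(0,1)$, $h(\rho)\to+\infty$ as $\rho\to1^-$, and $h(\rho)\to-\mathfrak C_{k,N}<0$ as $\rho\to0^+$. -/

import Mathlib

open Set Filter Topology MeasureTheory

noncomputable section

namespace AnnulusGreen

/-- The open annulus `{x ∈ ℝ^N : ρ < |x| < 1}`. -/
def annulus (N : ℕ) (ρ : ℝ) : Set (EuclideanSpace ℝ (Fin N)) :=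
  {x | ρ < ‖x‖ ∧ ‖x‖ < 1}

/-- `ω_{N-1}`, the surface measure of the unit sphere of `ℝ^N`. -/
def sphereArea (N : ℕ) : ℝ :=
  (volume : Measure (EuclideanSpace ℝ (Fin N))).toSphere.real univ

/-- The fundamental solution `1 / (ω_{N-1} (N-2) |x|^{N-2})` of `-Δ` on `ℝ^N`, `N ≥ 3`. -/
def fundamentalSolution (N : ℕ) (x : EuclideanSpace ℝ (Fin N)) : ℝ :=
  1 / (sphereArea N * ((N : ℝ) - 2)) * (1 / ‖x‖ ^ (N - 2))

/-- `h` is the corrector for the pole `y`: it is harmonic in `Ω`, continuous up to the boundary,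
and equal to `x ↦ Γ(x - y)` on the boundary, `Γ` being the fundamental solution. Equivalently
`G(·, y) = Γ(· - y) - h` solves `-Δ G(·, y) = δ_y` in `Ω` and `G(·, y) = 0` on `∂Ω`. -/
def IsCorrector {N : ℕ} (Ω : Set (EuclideanSpace ℝ (Fin N))) (y : EuclideanSpace ℝ (Fin N))
    (h : EuclideanSpace ℝ (Fin N) → ℝ) : Prop :=
  InnerProductSpace.HarmonicOnNhd h Ω ∧ ContinuousOn h (closure Ω) ∧
    ∀ x ∈ frontier Ω, h x = fundamentalSolution N (x - y)

open Classical in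
/-- The regular part `H(x, y)` of the Green function: the value at `x` of the corrector for the
pole `y`. On a bounded open set the corrector is unique on the closure (maximum principle), and
on an annulus it exists; the value `0` is a mere convention for sets without a corrector. -/
def regularPart {N : ℕ} (Ω : Set (EuclideanSpace ℝ (Fin N)))
    (x y : EuclideanSpace ℝ (Fin N)) : ℝ :=
  if h : ∃ u, IsCorrector Ω y u then h.choose x else 0

/-- The Dirichlet Green function `G(x, y) = Γ(x - y) - H(x, y)` (for `x ≠ y`). -/
def green {N : ℕ} (Ω : Set (EuclideanSpace ℝ (Fin N)))
    (x y : EuclideanSpace ℝ (Fin N)) : ℝ :=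
  fundamentalSolution N (x - y) - regularPart Ω x y

/-- The Robin function `τ(x) = H(x, x)`. -/
def robin {N : ℕ} (Ω : Set (EuclideanSpace ℝ (Fin N))) (x : EuclideanSpace ℝ (Fin N)) : ℝ :=
  regularPart Ω x x

/-- The points `(r cos (2πj/k), r sin (2πj/k), 0, …, 0)`, `j = 0, …, k-1`. -/
def polygonPoint (N k : ℕ) (r : ℝ) (j : Fin k) : EuclideanSpace ℝ (Fin N) :=
  WithLp.toLp 2 fun i : Fin N =>
    if (i : ℕ) = 0 then r * Real.cos (2 * Real.pi * (j : ℕ) / k)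
    else if (i : ℕ) = 1 then r * Real.sin (2 * Real.pi * (j : ℕ) / k)
    else 0

/-- The matrix with diagonal entries `τ(ξ_i)` and off-diagonal entries `-G(ξ_i, ξ_j)`. -/
def interactionMatrix {N k : ℕ} (Ω : Set (EuclideanSpace ℝ (Fin N)))
    (ξ : Fin k → EuclideanSpace ℝ (Fin N)) : Matrix (Fin k) (Fin k) ℝ :=
  Matrix.of fun i j => if i = j then robin Ω (ξ i) else -green Ω (ξ i) (ξ j)

/-- The first (least) eigenvalue of a real matrix; meant for symmetric matrices of positive size,
whose set of real eigenvalues is finite and nonempty. -/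
def firstEigenvalue {k : ℕ} (M : Matrix (Fin k) (Fin k) ℝ) : ℝ :=
  sInf {μ : ℝ | Module.End.HasEigenvalue (Matrix.toLin' M) μ}

/-- `Λ₁(r)` for the annulus with inner radius `ρ`: the first eigenvalue of the matrix of the
vertices of the regular `k`-gon of radius `r`. -/
def Lambda1 (N k : ℕ) (ρ r : ℝ) : ℝ :=
  firstEigenvalue (interactionMatrix (annulus N ρ) (polygonPoint N k r))

/-- `min_{r ∈ (ρ,1)} Λ₁(r)`. -/
def minLambda1 (N k : ℕ) (ρ : ℝ) : ℝ :=
  sInf (Lambda1 N k ρ '' Ioo ρ 1)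

/-- The Gegenbauer polynomial `C_m^lam (t)`: the coefficient of `r^m` in the expansion of
`(1 - 2 r t + r^2)^{-lam}` at `r = 0`. -/
def gegenbauer (lam : ℝ) (m : ℕ) (t : ℝ) : ℝ :=
  iteratedDeriv m (fun r : ℝ => (1 - 2 * r * t + r ^ 2) ^ (-lam)) 0 / (m.factorial : ℝ)

/-- `α_{k,m,N} = binom(N+m-3, N-3) + ∑_{j=1}^{k-1} C_m^{(N-2)/2}(cos (2πj/k))`. -/
def alpha (k m N : ℕ) : ℝ :=
  (Nat.choose (N + m - 3) (N - 3) : ℝ) +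
    ∑ j ∈ Finset.Icc 1 (k - 1),
      gegenbauer (((N : ℝ) - 2) / 2) m (Real.cos (2 * Real.pi * (j : ℝ) / (k : ℝ)))

/-- `C_{k,N} = ∑_{j=1}^{k-1} (2 sin (πj/k))^{-(N-2)}`. -/
def polygonConst (k N : ℕ) : ℝ :=
  ∑ j ∈ Finset.Icc 1 (k - 1), 1 / (2 * Real.sin (Real.pi * (j : ℝ) / (k : ℝ))) ^ (N - 2)

/-- The `m`-th term `α_{k,m,N} · 2 ρ^{(2m+N-2)/2} / (1 + ρ^{(2m+N-2)/2})`. -/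
def closedFormTerm (N k : ℕ) (ρ : ℝ) (m : ℕ) : ℝ :=
  alpha k m N * (2 * ρ ^ ((2 * (m : ℝ) + (N : ℝ) - 2) / 2) /
    (1 + ρ ^ ((2 * (m : ℝ) + (N : ℝ) - 2) / 2)))

/-- `h(ρ) = ∑_m α_{k,m,N} · 2 ρ^{(2m+N-2)/2} / (1 + ρ^{(2m+N-2)/2}) - C_{k,N}`. -/
def closedForm (N k : ℕ) (ρ : ℝ) : ℝ :=
  (∑' m : ℕ, closedFormTerm N k ρ m) - polygonConst k N

end AnnulusGreen

end

noncomputable section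

namespace AnnulusGreen

/-! Everything reduces to an explicit formula for `Λ₁`. Reflecting the pole alternately in the two
boundary spheres gives the regular part of the Green function as four series of fundamental
solutions (`isCorrector_imageSeries`), and the maximum principle identifies it with `regularPart`.
For two points on the sphere of radius `r`, the four series, multiplied by `r^(N-2)`, become values
of one series in `v` at `v = r`, `v = ρ` (twice) and `v = ρ/r` (`pow_mul_imageSeries`).

The matrix of the regular polygon has constant row sums, and its off-diagonal entries are
nonpositive because `G ≥ 0` (`imageSeries_le`). Hence the row sum is the least eigenvalue, with the
constant eigenvector (`firstEigenvalue_eq_of_row_sum`). Summing the Gegenbauer expansion over the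
vertices gives, with `L = 2m + N - 2`, `r^(N-2) Λ₁(r) = (∑ α_m (r^L - 2ρ^L + (ρ/r)^L) / (1 - ρ^L) -
C) / (ω (N-2))` (`pow_mul_Lambda1_eq`).

The decisive fact is `α_m ≥ 0` (`alpha_nonneg`), a consequence of the nonnegativity of sums of
characters over the `k`-th roots of unity. By AM-GM every term is then minimal at the same radius `r
= √ρ`, where `2(√ρ^L - ρ^L)/(1 - ρ^L) = 2√ρ^L/(1 + √ρ^L)`; this is the series `h`. Its terms are
nondecreasing in `ρ`, and the one with `m = 0` strictly increasing, so `h` has a single zero by its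
limits at `0` and `1`. The minimum of `Λ₁` itself may sit at another radius, but since `r^(N-2) > 0`
it has the same sign as `h`. -/

/-! ### Gegenbauer expansions and positivity of the coefficients `α`. -/

/-- The Taylor coefficients at `0` of a function which is the sum of a power series on `(-1, 1)`. -/
theorem iteratedDeriv_div_factorial_of_hasSum {a : ℕ → ℝ} {f : ℝ → ℝ}
    (h : ∀ s : ℝ, |s| < 1 → HasSum (fun m => a m * s ^ m) (f s)) (m : ℕ) :
    iteratedDeriv m f 0 / (m.factorial : ℝ) = a m := by
  have hp : HasFPowerSeriesOnBall f (FormalMultilinearSeries.ofScalars ℝ a) 0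
      ((1 / 2 : NNReal) : ENNReal) := by
    refine ⟨?_, by simp, ?_⟩
    · refine FormalMultilinearSeries.le_radius_of_summable _ ?_
      have h1 := ((h (1 / 2) (by norm_num [abs_of_pos])).summable).abs
      refine h1.congr fun n => ?_
      simp [abs_mul]
    · intro y hy
      have hy' : |y| < 1 := by
        have : ‖y‖₊ < (1 / 2 : NNReal) := by
          rw [Metric.mem_eball, edist_zero_right, enorm_eq_nnnorm] at hy
          exact_mod_cast hy
        have h2 : (‖y‖₊ : ℝ) < ((1 / 2 : NNReal) : ℝ) := by exact_mod_cast this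
        rw [coe_nnnorm, Real.norm_eq_abs] at h2
        push_cast at h2
        linarith
      have := h y hy'
      simpa [FormalMultilinearSeries.ofScalars_apply_eq, mul_comm] using this
  have h1 := hp.factorial_smul 1 m
  rw [div_eq_iff (by positivity), iteratedDeriv_eq_iteratedFDeriv, ← h1]
  simp [mul_comm]

/-- The coefficient of `z ^ n` in `(1 - z) ^ (-lam)`. -/
def binomCoeff (lam : ℝ) (n : ℕ) : ℝ := Ring.choose (lam + n - 1) n

/-- Up to the factor `n!` this is the rising factorial of `lam`, a product of positive numbers. -/
theorem binomCoeff_nonneg {lam : ℝ} (h : 0 < lam) (n : ℕ) : 0 ≤ binomCoeff lam n := by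
  have h1 := Ring.factorial_nsmul_multichoose_eq_ascPochhammer lam n
  rw [Polynomial.ascPochhammer_smeval_eq_eval, Ring.multichoose_eq, nsmul_eq_mul] at h1
  have h2 := ascPochhammer_pos n lam h
  rw [← h1] at h2
  exact (pos_of_mul_pos_right h2 (by positivity)).le

theorem hasSum_binomCoeff (lam : ℝ) {z : ℂ} (hz : ‖z‖ < 1) :
    HasSum (fun n => (binomCoeff lam n : ℂ) * z ^ n) (1 / (1 - z) ^ (lam : ℂ)) := by
  have h := Complex.one_div_one_sub_cpow_hasFPowerSeriesOnBall_zero (lam : ℂ)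
  have h1 := h.hasSum (y := z) (by simpa [enorm_eq_nnnorm] using! hz)
  simp only [zero_add] at h1
  convert! h1 using 1
  ext n
  simp [binomCoeff, Complex.ofReal_choose, mul_comm]

theorem summable_norm_binomCoeff {lam : ℝ} (hl : 0 < lam) {z : ℂ} (hz : ‖z‖ < 1) :
    Summable (fun n => ‖(binomCoeff lam n : ℂ) * z ^ n‖) := by
  have h := (hasSum_binomCoeff lam (z := (‖z‖ : ℂ)) (by simpa using hz)).summable
  rw [← Complex.summable_ofReal]
  refine h.congr fun n => ?_
  simp [abs_of_nonneg (binomCoeff_nonneg hl n)]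

/-- The coefficient `∑_{a+b=m} c_a c_b cos((a-b)θ)` of the Gegenbauer generating function. -/
def gegenbauerCos (lam θ : ℝ) (m : ℕ) : ℝ :=
  ∑ i ∈ Finset.range (m + 1),
    binomCoeff lam i * binomCoeff lam (m - i) * Real.cos (((i : ℝ) - ((m - i : ℕ) : ℝ)) * θ)

/-- With `z = s e^{iθ}` the quadratic factors as `(1 - z)(1 - z̄)`, so the expansion is the real
part of the Cauchy product of two binomial series. -/
theorem hasSum_gegenbauerCos {lam : ℝ} (hl : 0 < lam) (θ : ℝ) {s : ℝ} (hs : |s| < 1) :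
    HasSum (fun m => gegenbauerCos lam θ m * s ^ m)
      ((1 - 2 * s * Real.cos θ + s ^ 2) ^ (-lam)) := by
  set z : ℂ := s * Complex.exp (θ * Complex.I) with hz
  set w : ℂ := s * Complex.exp (-θ * Complex.I) with hw
  have hzn : ‖z‖ < 1 := by simpa [hz, Complex.norm_exp] using hs
  have hwn : ‖w‖ < 1 := by simpa [hw, Complex.norm_exp] using hs
  have hwz : w = (starRingEnd ℂ) z := by
    simp [hw, hz, ← Complex.exp_conj]
  have h := hasSum_sum_range_mul_of_summable_norm (summable_norm_binomCoeff hl hzn)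
    (summable_norm_binomCoeff hl hwn)
  rw [(hasSum_binomCoeff lam hzn).tsum_eq, (hasSum_binomCoeff lam hwn).tsum_eq] at h
  have h2 := Complex.hasSum_re h
  -- Keeps `1 - z` off the branch cut, so that complex powers commute with conjugation.
  have hre : 0 < (1 - z).re := by
    have := Complex.re_le_norm z
    simp; linarith
  have harg : (1 - z).arg ≠ Real.pi := by
    intro h0
    have := (Complex.arg_eq_pi_iff.1 h0).1
    linarith
  have hval : 1 / (1 - z) ^ (lam : ℂ) * (1 / (1 - w) ^ (lam : ℂ)) =
      (((1 - 2 * s * Real.cos θ + s ^ 2) ^ (-lam) : ℝ) : ℂ) := by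
    have e1 : (1 - w) ^ (lam : ℂ) = (starRingEnd ℂ) ((1 - z) ^ (lam : ℂ)) := by
      have := Complex.conj_cpow (1 - z) (lam : ℂ) harg
      rw [Complex.conj_ofReal] at this
      rw [hwz, ← this, map_sub, map_one]
    have e2 : ‖1 - z‖ ^ 2 = 1 - 2 * s * Real.cos θ + s ^ 2 := by
      rw [← Complex.normSq_eq_norm_sq, Complex.normSq_apply]
      have hzr : z.re = s * Real.cos θ := by simp [hz, Complex.exp_ofReal_mul_I_re]
      have hzi : z.im = s * Real.sin θ := by simp [hz, Complex.exp_ofReal_mul_I_im]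
      simp only [Complex.sub_re, Complex.one_re, Complex.sub_im, Complex.one_im, hzr, hzi]
      linear_combination s ^ 2 * Real.sin_sq_add_cos_sq θ
    rw [e1, one_div_mul_one_div, Complex.mul_conj, Complex.normSq_eq_norm_sq,
      Complex.norm_cpow_real, ← e2, Real.rpow_neg (by positivity), one_div, ← Complex.ofReal_inv,
      ← Real.rpow_natCast, ← Real.rpow_natCast, ← Real.rpow_mul (by positivity),
      ← Real.rpow_mul (by positivity), mul_comm lam]
  rw [hval, Complex.ofReal_re] at h2
  convert! h2 using 1
  ext m
  rw [gegenbauerCos, Finset.sum_mul, Complex.re_sum]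
  refine Finset.sum_congr rfl fun i hi => ?_
  have him : i ≤ m := Nat.lt_succ_iff.1 (Finset.mem_range.1 hi)
  have e3 : (binomCoeff lam i : ℂ) * z ^ i * ((binomCoeff lam (m - i) : ℂ) * w ^ (m - i)) =
      ((binomCoeff lam i * binomCoeff lam (m - i) * s ^ m : ℝ) : ℂ) *
        Complex.exp (((((i : ℝ) - ((m - i : ℕ) : ℝ)) * θ : ℝ) : ℂ) * Complex.I) := by
    rw [hz, hw, mul_pow, mul_pow, ← Complex.exp_nat_mul, ← Complex.exp_nat_mul]
    have e4 : (s : ℂ) ^ m = s ^ i * s ^ (m - i) := by rw [← pow_add, Nat.add_sub_cancel' him]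
    have e5 : Complex.exp (((((i : ℝ) - ((m - i : ℕ) : ℝ)) * θ : ℝ) : ℂ) * Complex.I) =
        Complex.exp (i * (θ * Complex.I)) * Complex.exp ((m - i : ℕ) * (-θ * Complex.I)) := by
      rw [← Complex.exp_add]
      congr 1
      push_cast
      ring
    rw [e5]
    push_cast
    rw [e4]
    ring
  rw [e3, Complex.re_ofReal_mul, Complex.exp_ofReal_mul_I_re]
  ring

theorem gegenbauer_cos {lam : ℝ} (hl : 0 < lam) (θ : ℝ) (m : ℕ) :
    gegenbauer lam m (Real.cos θ) = gegenbauerCos lam θ m :=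
  iteratedDeriv_div_factorial_of_hasSum (fun _ hs => hasSum_gegenbauerCos hl θ hs) m

theorem sq_rpow_neg_half {N : ℕ} (hN : 3 ≤ N) {a : ℝ} (ha : 0 ≤ a) :
    (a ^ 2) ^ (-(((N : ℝ) - 2) / 2)) = 1 / a ^ (N - 2) := by
  have h2 : ((N - 2 : ℕ) : ℝ) = (N : ℝ) - 2 := by
    rw [Nat.cast_sub (by omega)]; norm_num
  rw [Real.rpow_neg (by positivity), one_div, ← Real.rpow_natCast a 2, ← Real.rpow_mul ha,
    ← Real.rpow_natCast a (N - 2), h2]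
  congr 2
  push_cast
  ring

/-- At `θ = 0` the generating function is `(1 - s)^{-(N-2)}`. Thus the binomial in `alpha` is the
missing vertex `j = 0` of the Gegenbauer sum. -/
theorem gegenbauerCos_zero {N : ℕ} (hN : 3 ≤ N) (m : ℕ) :
    gegenbauerCos (((N : ℝ) - 2) / 2) 0 m = (Nat.choose (N + m - 3) (N - 3) : ℝ) := by
  have hN' : (3 : ℝ) ≤ N := by exact_mod_cast hN
  rw [← iteratedDeriv_div_factorial_of_hasSum
    (fun _ hs => hasSum_gegenbauerCos (by linarith : (0 : ℝ) < ((N : ℝ) - 2) / 2) 0 hs) m,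
    iteratedDeriv_div_factorial_of_hasSum
      (a := fun m => (Nat.choose (N + m - 3) (N - 3) : ℝ)) _ m]
  intro s hs
  have h := hasSum_choose_mul_geometric_of_norm_lt_one (N - 3) (r := s) (by simpa using hs)
  have e : (1 - 2 * s * Real.cos 0 + s ^ 2) ^ (-(((N : ℝ) - 2) / 2)) =
      1 / (1 - s) ^ (N - 3 + 1) := by
    rw [show N - 3 + 1 = N - 2 by omega, ← sq_rpow_neg_half hN (by linarith [le_abs_self s])]
    congr 1
    rw [Real.cos_zero]; ring
  rw [e]
  have e' : ∀ n, N + n - 3 = n + (N - 3) := fun n => by omega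
  simpa only [e'] using h

theorem alpha_eq_sum {N k : ℕ} (hN : 3 ≤ N) (hk : 1 ≤ k) (m : ℕ) :
    alpha k m N = ∑ j ∈ Finset.range k,
      gegenbauerCos (((N : ℝ) - 2) / 2) (2 * Real.pi * (j : ℝ) / (k : ℝ)) m := by
  have hN' : (3 : ℝ) ≤ N := by exact_mod_cast hN
  have hr : Finset.range k = insert 0 (Finset.Icc 1 (k - 1)) := by
    ext j; simp; omega
  rw [hr, Finset.sum_insert (by simp), alpha]
  congr 1
  · rw [← gegenbauerCos_zero hN]; simp
  · exact Finset.sum_congr rfl fun j _ => gegenbauer_cos (by linarith) _ _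

/-- A geometric sum of powers of a `k`-th root of unity is `k` or `0`. -/
theorem sum_cos_nonneg {k : ℕ} (hk : 1 ≤ k) (l : ℤ) :
    0 ≤ ∑ j ∈ Finset.range k, Real.cos ((l : ℝ) * (2 * Real.pi * (j : ℝ) / (k : ℝ))) := by
  have hk0 : (k : ℂ) ≠ 0 := by exact_mod_cast (by omega : k ≠ 0)
  set ζ : ℂ := Complex.exp (l * (2 * Real.pi * Complex.I) / k) with hζ
  have hterm : ∀ j : ℕ, Real.cos ((l : ℝ) * (2 * Real.pi * (j : ℝ) / (k : ℝ))) = (ζ ^ j).re := by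
    intro j
    rw [hζ, ← Complex.exp_nat_mul, ← Complex.exp_ofReal_mul_I_re]
    congr 2
    push_cast
    ring
  have hsum : ∑ j ∈ Finset.range k, Real.cos ((l : ℝ) * (2 * Real.pi * (j : ℝ) / (k : ℝ))) =
      (∑ j ∈ Finset.range k, ζ ^ j).re := by
    rw [Complex.re_sum]; exact Finset.sum_congr rfl fun j _ => hterm j
  rw [hsum]
  by_cases h1 : ζ = 1
  · simp [h1]
  · have hζk : ζ ^ k = 1 := by
      rw [hζ, ← Complex.exp_nat_mul, mul_div_cancel₀ _ hk0]
      exact Complex.exp_int_mul_two_pi_mul_I l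
    rw [geom_sum_eq h1, hζk]
    simp

/-- A single Gegenbauer value may be negative; after exchanging the sums, each cosine mode has a
nonnegative weight and a nonnegative sum over the vertices. -/
theorem alpha_nonneg {N k : ℕ} (hN : 3 ≤ N) (hk : 1 ≤ k) (m : ℕ) : 0 ≤ alpha k m N := by
  have hN' : (3 : ℝ) ≤ N := by exact_mod_cast hN
  have hl : (0 : ℝ) < ((N : ℝ) - 2) / 2 := by linarith
  rw [alpha_eq_sum hN hk]
  simp only [gegenbauerCos]
  rw [Finset.sum_comm]
  refine Finset.sum_nonneg fun i _ => ?_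
  rw [← Finset.mul_sum]
  refine mul_nonneg (mul_nonneg (binomCoeff_nonneg hl _) (binomCoeff_nonneg hl _)) ?_
  have := sum_cos_nonneg hk ((i : ℤ) - ((m - i : ℕ) : ℤ))
  push_cast at this
  exact this

theorem alpha_zero {N k : ℕ} (hN : 3 ≤ N) (hk : 1 ≤ k) : alpha k 0 N = k := by
  rw [alpha_eq_sum hN hk]
  simp [gegenbauerCos, binomCoeff]

/-- The generating function of the coefficients `alpha k m N`. -/
def alphaGen (N k : ℕ) (u : ℝ) : ℝ :=
  ∑ j ∈ Finset.range k, (1 - 2 * u * Real.cos (2 * Real.pi * (j : ℝ) / (k : ℝ)) + u ^ 2) ^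
    (-(((N : ℝ) - 2) / 2))

theorem hasSum_alpha {N k : ℕ} (hN : 3 ≤ N) (hk : 1 ≤ k) {u : ℝ} (hu : |u| < 1) :
    HasSum (fun m => alpha k m N * u ^ m) (alphaGen N k u) := by
  have hN' : (3 : ℝ) ≤ N := by exact_mod_cast hN
  have h := hasSum_sum (s := Finset.range k) fun j _ =>
    hasSum_gegenbauerCos (by linarith : (0 : ℝ) < ((N : ℝ) - 2) / 2)
      (2 * Real.pi * (j : ℝ) / (k : ℝ)) hu
  convert! h using 1
  ext m
  rw [alpha_eq_sum hN hk, Finset.sum_mul]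

/-- Keeps only the vertex `j = 0`, the source of all the blow-up used later. -/
theorem one_div_le_alphaGen {N k : ℕ} (hN : 3 ≤ N) (hk : 1 ≤ k) {u : ℝ} (hu1 : u < 1) :
    1 / (1 - u) ^ (N - 2) ≤ alphaGen N k u := by
  have h0 : (1 - 2 * u * Real.cos (2 * Real.pi * ((0 : ℕ) : ℝ) / (k : ℝ)) + u ^ 2) ^
      (-(((N : ℝ) - 2) / 2)) = 1 / (1 - u) ^ (N - 2) := by
    rw [← sq_rpow_neg_half hN (by linarith)]
    congr 1
    simp; ring
  rw [← h0]
  refine Finset.single_le_sum (f := fun j : ℕ =>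
    (1 - 2 * u * Real.cos (2 * Real.pi * (j : ℝ) / (k : ℝ)) + u ^ 2) ^ (-(((N : ℝ) - 2) / 2)))
    (fun j _ => Real.rpow_nonneg ?_ _) (Finset.mem_range.2 (by omega))
  nlinarith [Real.sin_sq_add_cos_sq (2 * Real.pi * (j : ℝ) / (k : ℝ)),
    sq_nonneg (u - Real.cos (2 * Real.pi * (j : ℝ) / (k : ℝ))),
    sq_nonneg (Real.sin (2 * Real.pi * (j : ℝ) / (k : ℝ)))]

theorem alphaGen_le {N k : ℕ} (hN : 3 ≤ N) {u : ℝ} (hu0 : 0 ≤ u) (hu1 : u < 1) :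
    alphaGen N k u ≤ k * (1 / (1 - u) ^ (N - 2)) := by
  have hN' : (3 : ℝ) ≤ N := by exact_mod_cast hN
  rw [← sq_rpow_neg_half hN (by linarith)]
  refine (Finset.sum_le_card_nsmul _ _ (((1 - u) ^ 2) ^ (-(((N : ℝ) - 2) / 2))) fun j _ => ?_).trans
    (by simp)
  refine Real.rpow_le_rpow_of_nonpos (by nlinarith) ?_ (by linarith)
  nlinarith [Real.cos_le_one (2 * Real.pi * (j : ℝ) / (k : ℝ))]

/-! ### Harmonicity of series of translated and dilated fundamental solutions. -/

section Harmonic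

set_option maxSynthPendingDepth 3

variable {E : Type*} [NormedAddCommGroup E] [InnerProductSpace ℝ E]

theorem laplacian_eq_sum_of_hasFDerivAt [FiniteDimensional ℝ E]
    {F : E → ℝ} {F' : E → E →L[ℝ] ℝ}
    {F'' : E →L[ℝ] E →L[ℝ] ℝ} {x : E}
    (h1 : ∀ᶠ y in 𝓝 x, HasFDerivAt F (F' y) y) (h2 : HasFDerivAt F' F'' x)
    {ι : Type*} [Fintype ι] (v : OrthonormalBasis ι ℝ E) :
    Laplacian.laplacian F x = ∑ i, F'' (v i) (v i) := by
  rw [InnerProductSpace.laplacian_eq_iteratedFDeriv_orthonormalBasis F v]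
  refine Finset.sum_congr rfl fun i _ => ?_
  have h3 : fderiv ℝ F =ᶠ[𝓝 x] F' := h1.mono fun y hy => hy.fderiv
  rw [iteratedFDeriv_two_apply, h3.fderiv_eq, h2.fderiv]
  simp

theorem harmonicOnNhd_of_hasFDerivAt [FiniteDimensional ℝ E]
    {F : E → ℝ} {F' : E → E →L[ℝ] ℝ}
    {F'' : E → E →L[ℝ] E →L[ℝ] ℝ} {U : Set E} (hU : IsOpen U)
    (h1 : ∀ x ∈ U, HasFDerivAt F (F' x) x) (h2 : ∀ x ∈ U, HasFDerivAt F' (F'' x) x)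
    (hc : ContinuousOn F'' U) {ι : Type*} [Fintype ι] (v : OrthonormalBasis ι ℝ E)
    (h0 : ∀ x ∈ U, ∑ i, F'' x (v i) (v i) = 0) :
    InnerProductSpace.HarmonicOnNhd F U := by
  have hC1 : ∀ x ∈ U, ContDiffAt ℝ 1 F' x := fun x hx => by
    have : ContDiffAt ℝ ((0 : ℕ) + 1) F' x := contDiffAt_succ_iff_hasFDerivAt.2
      ⟨F'', ⟨U, hU.mem_nhds hx, h2⟩,
        by simpa using contDiffAt_zero.2 ⟨U, hU.mem_nhds hx, hc⟩⟩
    simpa using this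
  intro x hx
  refine ⟨?_, ?_⟩
  · have : ContDiffAt ℝ ((1 : ℕ) + 1) F x := contDiffAt_succ_iff_hasFDerivAt.2
      ⟨F', ⟨U, hU.mem_nhds hx, h1⟩, by simpa using hC1 x hx⟩
    norm_num at this
    exact this
  · filter_upwards [hU.mem_nhds hx] with y hy
    rw [laplacian_eq_sum_of_hasFDerivAt (eventually_of_mem (hU.mem_nhds hy) h1) (h2 y hy) v]
    exact h0 y hy

theorem hasFDerivAt_tsum_of_isOpen {G : Type*} [NormedAddCommGroup G] [NormedSpace ℝ G]
    [CompleteSpace G] {κ : Type*} {f : κ → E → G} {f' : κ → E → E →L[ℝ] G} {U : Set E}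
    (hU : IsOpen U) {u : κ → ℝ} (hu : Summable u)
    (hf : ∀ i, ∀ x ∈ U, HasFDerivAt (f i) (f' i x) x) (hb : ∀ i, ∀ x ∈ U, ‖f' i x‖ ≤ u i)
    (hs : ∀ x ∈ U, Summable fun i => f i x) {x : E} (hx : x ∈ U) :
    HasFDerivAt (fun y => ∑' i, f i y) (∑' i, f' i x) x := by
  obtain ⟨ε, hε, hB⟩ := Metric.isOpen_iff.1 hU x hx
  exact hasFDerivAt_tsum_of_isPreconnected hu Metric.isOpen_ball
    (convex_ball x ε).isPreconnected (fun i y hy => hf i y (hB hy))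
    (fun i y hy => hb i y (hB hy)) (Metric.mem_ball_self hε) (hs x hx) (Metric.mem_ball_self hε)

/-- The summable bounds allow two termwise differentiations, and the trace of the second derivative
is a finite sum, so it passes through the series. -/
theorem harmonicOnNhd_tsum [FiniteDimensional ℝ E]
    {κ : Type*} {f : κ → E → ℝ} {f' : κ → E → E →L[ℝ] ℝ}
    {f'' : κ → E → E →L[ℝ] E →L[ℝ] ℝ} {U : Set E} (hU : IsOpen U) {u₁ u₂ : κ → ℝ}
    (h1 : ∀ i, ∀ x ∈ U, HasFDerivAt (f i) (f' i x) x)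
    (h2 : ∀ i, ∀ x ∈ U, HasFDerivAt (f' i) (f'' i x) x)
    (hc : ∀ i, ContinuousOn (f'' i) U)
    (hs : ∀ x ∈ U, Summable fun i => f i x)
    (hu₁ : Summable u₁) (hb₁ : ∀ i, ∀ x ∈ U, ‖f' i x‖ ≤ u₁ i)
    (hu₂ : Summable u₂) (hb₂ : ∀ i, ∀ x ∈ U, ‖f'' i x‖ ≤ u₂ i)
    {ι : Type*} [Fintype ι] (v : OrthonormalBasis ι ℝ E)
    (h0 : ∀ i, ∀ x ∈ U, ∑ e, f'' i x (v e) (v e) = 0) :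
    InnerProductSpace.HarmonicOnNhd (fun x => ∑' i, f i x) U := by
  have hs' : ∀ x ∈ U, Summable fun i => f' i x := fun x hx =>
    Summable.of_norm_bounded hu₁ fun i => hb₁ i x hx
  have hs'' : ∀ x ∈ U, Summable fun i => f'' i x := fun x hx =>
    Summable.of_norm_bounded hu₂ fun i => hb₂ i x hx
  refine harmonicOnNhd_of_hasFDerivAt (F' := fun x => ∑' i, f' i x)
    (F'' := fun x => ∑' i, f'' i x) hU ?_ ?_ ?_ v ?_
  · exact fun x hx => hasFDerivAt_tsum_of_isOpen hU hu₁ h1 hb₁ hs hx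
  · exact fun x hx => hasFDerivAt_tsum_of_isOpen hU hu₂ h2 hb₂ hs' hx
  · exact continuousOn_tsum hc hu₂ fun i x hx => hb₂ i x hx
  · intro x hx
    have hh := (hs'' x hx).hasSum
    have h3 : ∀ e, HasSum (fun i => f'' i x (v e) (v e)) ((∑' i, f'' i x) (v e) (v e)) :=
      fun e => (hh.mapL (ContinuousLinearMap.apply ℝ (E →L[ℝ] ℝ) (v e))).mapL
        (ContinuousLinearMap.apply ℝ ℝ (v e))
    have h4 := hasSum_sum (s := Finset.univ) fun e _ => h3 e
    simp only [h0 _ x hx] at h4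
    exact h4.unique hasSum_zero

/-- The real inner product as a bilinear (rather than sesquilinear) continuous map. -/
def innerCLM : E →L[ℝ] E →L[ℝ] ℝ := innerSL ℝ

@[simp]
theorem innerCLM_apply_apply (v w : E) : innerCLM v w = inner ℝ v w := rfl

/-- The power `‖v‖ ^ (2p)`, written as a power of the smooth function `‖v‖ ^ 2`. -/
def normSqPow (p : ℝ) (v : E) : ℝ := (‖v‖ ^ 2) ^ p

/-- The derivative of `normSqPow p`. -/
def normSqPowDeriv (p : ℝ) (v : E) : E →L[ℝ] ℝ := (2 * p * (‖v‖ ^ 2) ^ (p - 1)) • innerCLM v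

/-- The second derivative of `normSqPow p`. -/
def normSqPowDeriv₂ (p : ℝ) (v : E) : E →L[ℝ] E →L[ℝ] ℝ :=
  (2 * p * (‖v‖ ^ 2) ^ (p - 1)) • innerCLM +
    ((4 * p * (p - 1) * (‖v‖ ^ 2) ^ (p - 2)) • innerCLM v).smulRight (innerCLM v)

theorem hasFDerivAt_normSq_rpow (p : ℝ) {v : E} (hv : v ≠ 0) :
    HasFDerivAt (fun v : E => (‖v‖ ^ 2) ^ p) ((2 * p * (‖v‖ ^ 2) ^ (p - 1)) • innerCLM v) v := by
  have h := (hasStrictFDerivAt_norm_sq v).hasFDerivAt.rpow_const (p := p)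
    (Or.inl (by positivity))
  convert! h using 1
  ext w
  simp
  ring

theorem hasFDerivAt_normSqPow (p : ℝ) {v : E} (hv : v ≠ 0) :
    HasFDerivAt (normSqPow p) (normSqPowDeriv p v) v :=
  hasFDerivAt_normSq_rpow p hv

theorem hasFDerivAt_normSqPowDeriv (p : ℝ) {v : E} (hv : v ≠ 0) :
    HasFDerivAt (normSqPowDeriv p) (normSqPowDeriv₂ p v) v := by
  have h := ((hasFDerivAt_normSq_rpow (p - 1) hv).const_mul (2 * p)).smul
    (innerCLM (E := E)).hasFDerivAt
  convert! h using 1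
  ext w z
  simp only [normSqPowDeriv₂, add_apply, smul_apply, ContinuousLinearMap.smulRight_apply,
    innerCLM_apply_apply, smul_eq_mul, show p - 1 - 1 = p - 2 by ring]
  ring

theorem continuousOn_normSqPowDeriv₂ (p : ℝ) :
    ContinuousOn (normSqPowDeriv₂ (E := E) p) {0}ᶜ := by
  have h : ∀ q : ℝ, ContinuousOn (fun v : E => (‖v‖ ^ 2) ^ q) {0}ᶜ := fun q v hv =>
    (hasFDerivAt_normSq_rpow q hv).continuousAt.continuousWithinAt
  have hi : Continuous fun v : E => innerCLM v := (innerCLM (E := E)).continuous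
  refine ContinuousOn.add (f := fun v : E => (2 * p * (‖v‖ ^ 2) ^ (p - 1)) • innerCLM (E := E))
    ((continuousOn_const.mul (h _)).smul continuousOn_const) ?_
  have h3 : ContinuousOn (fun v : E => (4 * p * (p - 1) * (‖v‖ ^ 2) ^ (p - 2)) • innerCLM v)
    {0}ᶜ := (continuousOn_const.mul (h _)).smul hi.continuousOn
  exact ((ContinuousLinearMap.smulRightL ℝ E (E →L[ℝ] ℝ)).continuous.comp_continuousOn h3).clm_apply
    hi.continuousOn

/-- In dimension `n` the trace is `2p (n + 2p - 2) ‖v‖^(2p-2)`, and `p = 1 - n/2` kills the bracket.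
-/
theorem trace_normSqPowDeriv₂ {ι : Type*} [Fintype ι] (b : OrthonormalBasis ι ℝ E) (v : E)
    (hv : v ≠ 0) :
    ∑ i, normSqPowDeriv₂ (1 - (Fintype.card ι : ℝ) / 2) v (b i) (b i) = 0 := by
  have hs : ∑ i, inner ℝ v (b i) * inner ℝ v (b i) = ‖v‖ ^ 2 := by
    rw [← b.sum_sq_norm_inner_right v]
    refine Finset.sum_congr rfl fun i _ => ?_
    rw [real_inner_comm, Real.norm_eq_abs, sq_abs, sq]
  set p : ℝ := 1 - (Fintype.card ι : ℝ) / 2 with hp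
  have hpow : (‖v‖ ^ 2) ^ (p - 1) = (‖v‖ ^ 2) ^ (p - 2) * ‖v‖ ^ 2 := by
    rw [← Real.rpow_add_one (by positivity)]
    congr 1; ring
  have : ∀ i, normSqPowDeriv₂ p v (b i) (b i) = 2 * p * (‖v‖ ^ 2) ^ (p - 1) +
      4 * p * (p - 1) * (‖v‖ ^ 2) ^ (p - 2) * (inner ℝ v (b i) * inner ℝ v (b i)) := by
    intro i
    simp [normSqPowDeriv₂]
    ring
  simp only [this]
  rw [Finset.sum_add_distrib, ← Finset.mul_sum (a := 4 * p * (p - 1) * (‖v‖ ^ 2) ^ (p - 2)), hs, hpow]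
  simp [hp]
  ring

theorem exists_bound_of_continuousOn_compl [FiniteDimensional ℝ E]
    {G : Type*} [NormedAddCommGroup G] {K : E → G}
    (hK : ContinuousOn K {0}ᶜ) {δ : ℝ} (hδ : 0 < δ) (M : ℝ) :
    ∃ C, 0 ≤ C ∧ ∀ v, δ ≤ ‖v‖ → ‖v‖ ≤ M → ‖K v‖ ≤ C := by
  have hc : IsCompact (Metric.closedBall (0 : E) M \ Metric.ball 0 δ) :=
    (isCompact_closedBall 0 M).diff Metric.isOpen_ball
  obtain ⟨C, hC⟩ := hc.exists_bound_of_continuousOn (hK.mono (by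
    rintro v ⟨_, hv⟩ (rfl : v = 0)
    simp [hδ] at hv))
  refine ⟨max C 0, le_max_right _ _, fun v h1 h2 => (hC v ⟨?_, ?_⟩).trans (le_max_left _ _)⟩
  · simpa using h2
  · simpa using h1

variable {κ : Type*} {w a : κ → ℝ} {b : κ → E} {S : Set E} {δ M : ℝ}

theorem summable_normSqPow_comp [FiniteDimensional ℝ E]
    (p : ℝ) (hw : Summable w) (hw0 : ∀ i, 0 ≤ w i) (hδ : 0 < δ)
    {x : E} (hl : ∀ i, δ ≤ ‖a i • x + b i‖) (hM : ∀ i, ‖a i • x + b i‖ ≤ M) :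
    Summable fun i => w i * normSqPow p (a i • x + b i) := by
  obtain ⟨C, hC0, hC⟩ := exists_bound_of_continuousOn_compl (K := normSqPow (E := E) p)
    (fun v hv => (hasFDerivAt_normSqPow p hv).continuousAt.continuousWithinAt) hδ M
  refine Summable.of_norm_bounded (hw.mul_right C) fun i => ?_
  rw [norm_mul, Real.norm_of_nonneg (hw0 i)]
  exact mul_le_mul_of_nonneg_left (hC _ (hl i) (hM i)) (hw0 i)

theorem continuousOn_tsum_normSqPow_comp [FiniteDimensional ℝ E]
    (p : ℝ) (hw : Summable w) (hw0 : ∀ i, 0 ≤ w i)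
    (hδ : 0 < δ) (hl : ∀ i, ∀ x ∈ S, δ ≤ ‖a i • x + b i‖) (hM : ∀ i, ∀ x ∈ S, ‖a i • x + b i‖ ≤ M) :
    ContinuousOn (fun x => ∑' i, w i * normSqPow p (a i • x + b i)) S := by
  have hK : ContinuousOn (normSqPow (E := E) p) {0}ᶜ :=
    fun v hv => (hasFDerivAt_normSqPow p hv).continuousAt.continuousWithinAt
  obtain ⟨C, hC0, hC⟩ := exists_bound_of_continuousOn_compl hK hδ M
  refine continuousOn_tsum (fun i => ?_) (hw.mul_right C) fun i x hx => ?_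
  · refine continuousOn_const.mul (hK.comp (by fun_prop) fun x hx => ?_)
    exact norm_pos_iff.1 (hδ.trans_le (hl i x hx))
  · rw [norm_mul, Real.norm_of_nonneg (hw0 i)]
    exact mul_le_mul_of_nonneg_left (hC _ (hl i x hx) (hM i x hx)) (hw0 i)

/-- All arguments stay in one compact shell, where the kernel and its derivatives are bounded; `|a
i| ≤ 1` absorbs the chain-rule factors, so `w` dominates everything. -/
theorem harmonicOnNhd_tsum_normSqPow_comp [FiniteDimensional ℝ E]
    {ι : Type*} [Fintype ι] (v : OrthonormalBasis ι ℝ E)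
    (hS : IsOpen S) (hw : Summable w) (hw0 : ∀ i, 0 ≤ w i) (ha : ∀ i, |a i| ≤ 1) (hδ : 0 < δ)
    (hl : ∀ i, ∀ x ∈ S, δ ≤ ‖a i • x + b i‖) (hM : ∀ i, ∀ x ∈ S, ‖a i • x + b i‖ ≤ M) :
    InnerProductSpace.HarmonicOnNhd
      (fun x => ∑' i, w i * normSqPow (1 - (Fintype.card ι : ℝ) / 2) (a i • x + b i)) S := by
  set p : ℝ := 1 - (Fintype.card ι : ℝ) / 2 with hp
  have hne : ∀ i, ∀ x ∈ S, a i • x + b i ≠ 0 := fun i x hx =>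
    norm_pos_iff.1 (hδ.trans_le (hl i x hx))
  have hK1 : ContinuousOn (normSqPowDeriv (E := E) p) {0}ᶜ :=
    fun v hv => (hasFDerivAt_normSqPowDeriv p hv).continuousAt.continuousWithinAt
  obtain ⟨C₁, hC₁0, hC₁⟩ := exists_bound_of_continuousOn_compl hK1 hδ M
  obtain ⟨C₂, hC₂0, hC₂⟩ := exists_bound_of_continuousOn_compl
    (G := E →L[ℝ] E →L[ℝ] ℝ)
    (continuousOn_normSqPowDeriv₂ (E := E) p) hδ M
  have haff : ∀ i (x : E), HasFDerivAt (fun x => a i • x + b i)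
      (a i • ContinuousLinearMap.id ℝ E) x := fun i x =>
    ((hasFDerivAt_id x).const_smul (a i)).add_const (b i)
  refine harmonicOnNhd_tsum (f' := fun i x => (w i * a i) • normSqPowDeriv p (a i • x + b i))
    (f'' := fun i x => (w i * a i * a i) • normSqPowDeriv₂ p (a i • x + b i))
    (u₁ := fun i => w i * C₁) (u₂ := fun i => w i * C₂) hS ?_ ?_ ?_ ?_
    (hw.mul_right _) ?_ (hw.mul_right _) ?_ v ?_
  · intro i x hx
    have h := ((hasFDerivAt_normSqPow p (hne i x hx)).comp x (haff i x)).const_mul (w i)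
    convert! h using 1
    ext z
    simp
    ring
  · intro i x hx
    have h := ((hasFDerivAt_normSqPowDeriv p (hne i x hx)).comp x (haff i x)).const_smul (w i * a i)
    convert! h using 1
    ext z
    simp
    ring
  · intro i
    exact ContinuousOn.const_smul
      ((continuousOn_normSqPowDeriv₂ p).comp (by fun_prop) (hne i)) (w i * a i * a i)
  · intro x hx
    exact summable_normSqPow_comp p hw hw0 hδ (fun i => hl i x hx) fun i => hM i x hx
  · intro i x hx
    rw [norm_smul, norm_mul, Real.norm_of_nonneg (hw0 i), Real.norm_eq_abs]
    have := mul_le_of_le_one_right (hw0 i) (ha i)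
    exact mul_le_mul this (hC₁ _ (hl i x hx) (hM i x hx)) (norm_nonneg _) (hw0 i)
  · intro i x hx
    refine (ContinuousLinearMap.opNorm_smul_le _ _).trans ?_
    rw [norm_mul, norm_mul, Real.norm_of_nonneg (hw0 i), Real.norm_eq_abs]
    have h1 := mul_le_of_le_one_right (hw0 i) (ha i)
    have h2 := (mul_le_of_le_one_right (mul_nonneg (hw0 i) (abs_nonneg (a i))) (ha i)).trans h1
    exact mul_le_mul h2 (hC₂ _ (hl i x hx) (hM i x hx)) (ContinuousLinearMap.opNorm_nonneg _) (hw0 i)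
  · intro i x hx
    simp only [smul_apply, smul_eq_mul]
    rw [← Finset.mul_sum, trace_normSqPowDeriv₂ v _ (hne i x hx), mul_zero]

end Harmonic

/-! ### The minimum principle. -/

/-- A negative second derivative would make `a` a local maximum as well, so `g` would be locally
constant and the second derivative zero. -/
theorem deriv_deriv_nonneg_of_isLocalMin {g : ℝ → ℝ} {a : ℝ} (hg : IsLocalMin g a)
    (hc : ContinuousAt g a) : 0 ≤ deriv (deriv g) a := by
  by_contra! h
  have hmax := isLocalMax_of_deriv_deriv_neg h hg.deriv_eq_zero hc
  have heq : g =ᶠ[𝓝 a] fun _ => g a := by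
    filter_upwards [hg, hmax] with x h1 h2
    exact le_antisymm h2 h1
  have h1 : deriv g =ᶠ[𝓝 a] fun _ => 0 := by
    filter_upwards [heq.eventuallyEq_nhds] with x hx
    rw [hx.deriv_eq, deriv_const]
  rw [h1.deriv_eq, deriv_const] at h
  exact lt_irrefl _ h

section MaximumPrinciple

set_option maxSynthPendingDepth 3

variable {E : Type*} [NormedAddCommGroup E] [InnerProductSpace ℝ E] [FiniteDimensional ℝ E]

theorem laplacian_nonneg_of_isLocalMin {v : E → ℝ} {z : E} (hv : ContDiffAt ℝ 2 v z)
    (hz : IsLocalMin v z) : 0 ≤ Laplacian.laplacian v z := by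
  have hv1 : ∀ᶠ y in 𝓝 z, HasFDerivAt v (fderiv ℝ v y) y := by
    filter_upwards [(hv.of_le one_le_two).eventually (by simp)] with y hy
    exact (hy.differentiableAt one_ne_zero).hasFDerivAt
  have hv2 : HasFDerivAt (fderiv ℝ v) (fderiv ℝ (fderiv ℝ v) z) z :=
    ((hv.fderiv_right (m := 1) (by norm_num)).differentiableAt one_ne_zero).hasFDerivAt
  rw [laplacian_eq_sum_of_hasFDerivAt hv1 hv2 (stdOrthonormalBasis ℝ E)]
  refine Finset.sum_nonneg fun i _ => ?_
  set e := stdOrthonormalBasis ℝ E i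
  have hline : ∀ t : ℝ, HasDerivAt (fun t : ℝ => z + t • e) e t := fun t => by
    simpa using ((hasDerivAt_id t).smul_const e).const_add z
  have hcont : Tendsto (fun t : ℝ => z + t • e) (𝓝 0) (𝓝 z) := by
    simpa using (hline 0).continuousAt.tendsto
  have hg : IsLocalMin (fun t : ℝ => v (z + t • e)) 0 := by
    filter_upwards [hcont.eventually hz] with t ht
    simpa using ht
  have hd1 : deriv (fun t : ℝ => v (z + t • e)) =ᶠ[𝓝 0] fun t => fderiv ℝ v (z + t • e) e := by
    filter_upwards [hcont.eventually hv1] with t ht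
    exact (ht.comp_hasDerivAt t (hline t)).deriv
  have hd2 : HasDerivAt (fun t : ℝ => fderiv ℝ v (z + t • e) e)
      (fderiv ℝ (fderiv ℝ v) z e e) 0 := by
    have h0 : z + (0 : ℝ) • e = z := by simp
    have h1 := HasFDerivAt.comp_hasDerivAt (f := fun t : ℝ => z + t • e) (0 : ℝ)
      (by rw [h0]; exact hv2) (hline 0)
    exact h1.clm_apply (hasDerivAt_const _ e) |>.congr_deriv (by simp)
  rw [← hd2.deriv, ← hd1.deriv_eq]
  refine deriv_deriv_nonneg_of_isLocalMin hg ?_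
  exact ContinuousAt.comp (by simpa using hv.continuousAt) (hline 0).continuousAt

theorem laplacian_norm_sq (z : E) :
    Laplacian.laplacian (fun x : E => ‖x‖ ^ 2) z = 2 * Module.finrank ℝ E := by
  have h1 : ∀ y : E, HasFDerivAt (fun x : E => ‖x‖ ^ 2) ((2 : ℝ) • innerCLM y) y := fun y => by
    convert! (hasStrictFDerivAt_norm_sq y).hasFDerivAt using 1
    ext w
    simp
  have h2 : HasFDerivAt (fun y : E => (2 : ℝ) • innerCLM y) ((2 : ℝ) • innerCLM (E := E)) z :=
    (innerCLM (E := E)).hasFDerivAt.const_smul (2 : ℝ)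
  rw [laplacian_eq_sum_of_hasFDerivAt (Eventually.of_forall h1) h2 (stdOrthonormalBasis ℝ E)]
  simp
  ring

/-- Minimum principle: a continuous function on a compact set is nonnegative if each point of the
set is either a point of nonnegativity or an interior point near which the function is harmonic. -/
theorem nonneg_of_harmonicAt_of_nonneg [Nontrivial E] {S : Set E} (hS : IsCompact S) {u : E → ℝ}
    (hu : ContinuousOn u S)
    (h : ∀ z ∈ S, 0 ≤ u z ∨ (z ∈ interior S ∧ InnerProductSpace.HarmonicAt u z))
    {x : E} (hx : x ∈ S) : 0 ≤ u x := by
  by_contra! hneg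
  obtain ⟨R, hR⟩ := hS.isBounded.exists_norm_le
  have hR2 : ∀ z ∈ S, ‖z‖ ^ 2 ≤ R ^ 2 + 1 := fun z hz => by
    have := pow_le_pow_left₀ (norm_nonneg z) (hR z hz) 2
    linarith
  -- Subtracting `ε‖z‖²` makes the Laplacian strictly negative at interior points of harmonicity,
  -- which excludes a minimum there. This `ε` is small enough that `u` is still negative at the
  -- minimiser.
  set ε : ℝ := -u x / (2 * (R ^ 2 + 1)) with hε
  have hε0 : 0 < ε := by
    apply div_pos <;> nlinarith [sq_nonneg R]
  have hεR : ε * (R ^ 2 + 1) = -u x / 2 := by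
    rw [hε]; field_simp
  obtain ⟨z, hz, hmin⟩ := hS.exists_isMinOn ⟨x, hx⟩
    (f := fun z => u z - ε * ‖z‖ ^ 2) (hu.sub (by fun_prop))
  have hle : u z - ε * ‖z‖ ^ 2 ≤ u x - ε * ‖x‖ ^ 2 := hmin hx
  have h1 : 0 ≤ ε * ‖x‖ ^ 2 := by positivity
  have h2 : ε * ‖z‖ ^ 2 ≤ ε * (R ^ 2 + 1) := mul_le_mul_of_nonneg_left (hR2 z hz) hε0.le
  rcases h z hz with h0 | ⟨hint, hharm⟩
  · linarith
  · have hloc : IsLocalMin (u - ε • fun z => ‖z‖ ^ 2) z :=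
      hmin.isLocalMin (mem_interior_iff_mem_nhds.1 hint)
    have hsq : ContDiffAt ℝ 2 (fun z : E => ‖z‖ ^ 2) z := (contDiff_norm_sq ℝ).contDiffAt
    have hsq' : ContDiffAt ℝ 2 (ε • fun z : E => ‖z‖ ^ 2) z := contDiffAt_const.smul hsq
    have h3 := laplacian_nonneg_of_isLocalMin (v := u - ε • fun z => ‖z‖ ^ 2)
      (hharm.1.sub hsq') hloc
    rw [hharm.1.laplacian_sub hsq', InnerProductSpace.laplacian_smul ε hsq, laplacian_norm_sq,
      hharm.2.self_of_nhds] at h3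
    have hN : (0 : ℝ) < Module.finrank ℝ E := by exact_mod_cast Module.finrank_pos
    simp at h3
    nlinarith [mul_pos hε0 hN]

end MaximumPrinciple

/-! ### The method of images in the annulus. -/

section Images

variable {N : ℕ} {ρ : ℝ}

theorem one_sub_half_eq (N : ℕ) : 1 - (N : ℝ) / 2 = -(((N : ℝ) - 2) / 2) := by ring

theorem isOpen_annulus (N : ℕ) (ρ : ℝ) : IsOpen (annulus N ρ) :=
  (isOpen_lt continuous_const continuous_norm).inter (isOpen_lt continuous_norm continuous_const)

theorem closure_annulus_subset (N : ℕ) (ρ : ℝ) :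
    closure (annulus N ρ) ⊆ {x | ρ ≤ ‖x‖ ∧ ‖x‖ ≤ 1} :=
  closure_minimal (fun _ hx => ⟨hx.1.le, hx.2.le⟩)
    ((isClosed_le continuous_const continuous_norm).inter
      (isClosed_le continuous_norm continuous_const))

theorem isCompact_closure_annulus (N : ℕ) (ρ : ℝ) : IsCompact (closure (annulus N ρ)) :=
  (Metric.isBounded_ball (x := (0 : EuclideanSpace ℝ (Fin N))) (r := 1)).subset
    (fun x hx => by simpa using hx.2) |>.isCompact_closure

theorem norm_of_mem_frontier_annulus {x : EuclideanSpace ℝ (Fin N)}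
    (hx : x ∈ frontier (annulus N ρ)) : ‖x‖ = ρ ∨ ‖x‖ = 1 := by
  rw [(isOpen_annulus N ρ).frontier_eq] at hx
  obtain ⟨h1, h2⟩ := closure_annulus_subset N ρ hx.1
  by_contra! h
  exact hx.2 ⟨lt_of_le_of_ne h1 h.1.symm, lt_of_le_of_ne h2 h.2⟩

/-- The fundamental solution as a multiple of a power of the squared norm. -/
theorem fundamentalSolution_eq (hN : 3 ≤ N) (x : EuclideanSpace ℝ (Fin N)) :
    fundamentalSolution N x =
      1 / (sphereArea N * ((N : ℝ) - 2)) * normSqPow (1 - (N : ℝ) / 2) x := by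
  rw [fundamentalSolution, normSqPow, one_sub_half_eq, sq_rpow_neg_half hN (norm_nonneg x)]

theorem nontrivial_euclideanSpace (hN : 3 ≤ N) : Nontrivial (EuclideanSpace ℝ (Fin N)) :=
  have : Nonempty (Fin N) := ⟨⟨0, by omega⟩⟩
  inferInstance

theorem sphereArea_pos (hN : 3 ≤ N) : 0 < sphereArea N := by
  have := nontrivial_euclideanSpace hN
  rw [sphereArea, MeasureTheory.Measure.toSphere_real_apply_univ]
  refine mul_pos (by exact_mod_cast Module.finrank_pos) ?_
  exact ENNReal.toReal_pos (Metric.measure_ball_pos _ _ one_pos).ne' measure_ball_lt_top.ne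

theorem greenConst_pos (hN : 3 ≤ N) : 0 < 1 / (sphereArea N * ((N : ℝ) - 2)) := by
  have : (3 : ℝ) ≤ N := by exact_mod_cast hN
  exact one_div_pos.2 (mul_pos (sphereArea_pos hN) (by linarith))

theorem norm_sq_smul_sub_smul (α β : ℝ) (x y : EuclideanSpace ℝ (Fin N)) :
    ‖α • x + (-β) • y‖ ^ 2 =
      α ^ 2 * ‖x‖ ^ 2 - 2 * α * β * inner ℝ x y + β ^ 2 * ‖y‖ ^ 2 := by
  rw [norm_add_sq_real, norm_smul, norm_smul, inner_smul_left, inner_smul_right, mul_pow, mul_pow]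
  simp
  ring

theorem sub_le_norm_smul_sub_smul {α β : ℝ} (hα : 0 ≤ α) (hβ : 0 ≤ β)
    (x y : EuclideanSpace ℝ (Fin N)) : α * ‖x‖ - β * ‖y‖ ≤ ‖α • x + (-β) • y‖ := by
  have := norm_sub_norm_le (α • x) (β • y)
  rwa [norm_smul, norm_smul, Real.norm_of_nonneg hα, Real.norm_of_nonneg hβ, sub_eq_add_neg (α • x),
    ← neg_smul] at this

theorem sub_le_norm_smul_sub_smul' {α β : ℝ} (hα : 0 ≤ α) (hβ : 0 ≤ β)
    (x y : EuclideanSpace ℝ (Fin N)) : β * ‖y‖ - α * ‖x‖ ≤ ‖α • x + (-β) • y‖ := by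
  have := norm_sub_norm_le (β • y) (α • x)
  rwa [norm_smul, norm_smul, Real.norm_of_nonneg hα, Real.norm_of_nonneg hβ, norm_sub_rev,
    sub_eq_add_neg (α • x), ← neg_smul] at this

theorem norm_smul_sub_smul_le {α β : ℝ} (hα : 0 ≤ α) (hβ : 0 ≤ β)
    (x y : EuclideanSpace ℝ (Fin N)) : ‖α • x + (-β) • y‖ ≤ α * ‖x‖ + β * ‖y‖ := by
  have := norm_add_le (α • x) ((-β) • y)
  rwa [norm_smul, norm_smul, norm_neg, Real.norm_of_nonneg hα, Real.norm_of_nonneg hβ] at this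

/-- A series of fundamental solutions with collinear poles. -/
def poleSeries (w α β : ℕ → ℝ) (x y : EuclideanSpace ℝ (Fin N)) : ℝ :=
  ∑' i, w i * normSqPow (1 - (N : ℝ) / 2) (α i • x + (-β i) • y)

/-- Weights and coefficients for which `poleSeries` converges nicely on the closed annulus. -/
structure IsPoleFamily (ρ : ℝ) (w α β : ℕ → ℝ) (y : EuclideanSpace ℝ (Fin N)) : Prop where
  summable : Summable w
  nonneg : ∀ i, 0 ≤ w i
  coeff_nonneg : ∀ i, 0 ≤ α i
  coeff_le_one : ∀ i, α i ≤ 1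
  pole_nonneg : ∀ i, 0 ≤ β i
  pole_le : ∀ i, β i * ‖y‖ ≤ 1
  exists_sep : ∃ δ > 0, ∀ x : EuclideanSpace ℝ (Fin N), ρ ≤ ‖x‖ → ‖x‖ ≤ 1 →
    ∀ i, δ ≤ ‖α i • x + (-β i) • y‖

namespace IsPoleFamily

variable {w α β : ℕ → ℝ} {y : EuclideanSpace ℝ (Fin N)}

theorem norm_le_two (h : IsPoleFamily ρ w α β y) {x : EuclideanSpace ℝ (Fin N)} (hx : ‖x‖ ≤ 1)
    (i : ℕ) : ‖α i • x + (-β i) • y‖ ≤ 2 := by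
  refine (norm_smul_sub_smul_le (h.coeff_nonneg i) (h.pole_nonneg i) x y).trans ?_
  have := mul_le_one₀ (h.coeff_le_one i) (norm_nonneg x) hx
  linarith [h.pole_le i]

theorem summable_pole (h : IsPoleFamily ρ w α β y) {x : EuclideanSpace ℝ (Fin N)}
    (hx : ρ ≤ ‖x‖) (hx1 : ‖x‖ ≤ 1) :
    Summable fun i => w i * normSqPow (1 - (N : ℝ) / 2) (α i • x + (-β i) • y) := by
  obtain ⟨δ, hδ, hs⟩ := h.exists_sep
  exact summable_normSqPow_comp _ h.summable h.nonneg hδ (hs x hx hx1) fun i => h.norm_le_two hx1 i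

theorem harmonicOnNhd (h : IsPoleFamily ρ w α β y) :
    InnerProductSpace.HarmonicOnNhd (fun x => poleSeries w α β x y) (annulus N ρ) := by
  obtain ⟨δ, hδ, hs⟩ := h.exists_sep
  have := harmonicOnNhd_tsum_normSqPow_comp (EuclideanSpace.basisFun (Fin N) ℝ)
    (isOpen_annulus N ρ) h.summable h.nonneg (a := α) (b := fun i => (-β i) • y)
    (fun i => by rw [abs_of_nonneg (h.coeff_nonneg i)]; exact h.coeff_le_one i) hδ
    (fun i x hx => hs x hx.1.le hx.2.le i) (fun i x hx => h.norm_le_two hx.2.le i)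
  simpa only [Fintype.card_fin, poleSeries] using this

theorem continuousOn (h : IsPoleFamily ρ w α β y) :
    ContinuousOn (fun x => poleSeries w α β x y) (closure (annulus N ρ)) := by
  obtain ⟨δ, hδ, hs⟩ := h.exists_sep
  refine ContinuousOn.mono ?_ (closure_annulus_subset N ρ)
  exact continuousOn_tsum_normSqPow_comp (b := fun i => (-β i) • y) _ h.summable h.nonneg hδ
    (fun i x hx => hs x hx.1 hx.2 i) (fun i x hx => h.norm_le_two hx.2 i)

end IsPoleFamily

theorem summable_pow_mul {n : ℕ} (hn : 1 ≤ n) (hρ0 : 0 < ρ) (hρ1 : ρ < 1) :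
    Summable fun i : ℕ => ρ ^ (n * i) := by
  simp only [pow_mul]
  exact summable_geometric_of_lt_one (by positivity) (pow_lt_one₀ hρ0.le hρ1 (by omega))

theorem summable_pow_mul_succ {n : ℕ} (hn : 1 ≤ n) (hρ0 : 0 < ρ) (hρ1 : ρ < 1) :
    Summable fun i : ℕ => ρ ^ (n * (i + 1)) :=
  (summable_nat_add_iff 1).2 (summable_pow_mul hn hρ0 hρ1)

variable {y : EuclideanSpace ℝ (Fin N)}

theorem pow_two_mul_succ_le (hρ0 : 0 < ρ) (hρ1 : ρ < 1) (i : ℕ) : ρ ^ (2 * (i + 1)) ≤ ρ ^ 2 :=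
  pow_le_pow_of_le_one hρ0.le hρ1.le (by omega)

/-- The pole in `x` is `(β/α) y`. Here it is `ρ^(-2i) y/‖y‖²`, and in the next three families
`ρ^(-2(i+1)) y`, `ρ^(2(i+1)) y/‖y‖²`, `ρ^(2(i+1)) y`: the first two lie beyond the unit sphere, the
last two inside the sphere of radius `ρ`. Writing `αx - βy` instead of `x - (β/α) y` keeps the
arguments bounded although the outer poles escape to infinity. -/
theorem isPoleFamily_outer (hN : 3 ≤ N) (hρ0 : 0 < ρ) (hρ1 : ρ < 1) (hy : y ∈ annulus N ρ) :
    IsPoleFamily ρ (fun i => ρ ^ ((N - 2) * i)) (fun i => ‖y‖ * ρ ^ (2 * i))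
      (fun _ => 1 / ‖y‖) y := by
  have hr : 0 < ‖y‖ := hρ0.trans hy.1
  have hα : ∀ i : ℕ, ‖y‖ * ρ ^ (2 * i) ≤ ‖y‖ := fun i =>
    mul_le_of_le_one_right hr.le (pow_le_one₀ hρ0.le hρ1.le)
  refine ⟨summable_pow_mul (by omega) hρ0 hρ1, fun i => by positivity, fun i => by positivity,
    fun i => (hα i).trans hy.2.le, fun i => by positivity, fun i => by field_simp; rfl,
    1 - ‖y‖, sub_pos.2 hy.2, fun x _ hx1 i => ?_⟩
  refine le_trans ?_ (sub_le_norm_smul_sub_smul' (by positivity) (by positivity) x y)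
  rw [one_div_mul_cancel hr.ne']
  have := mul_le_of_le_one_right (by positivity : 0 ≤ ‖y‖ * ρ ^ (2 * i)) hx1
  linarith [hα i]

theorem isPoleFamily_outer' (hN : 3 ≤ N) (hρ0 : 0 < ρ) (hρ1 : ρ < 1) (hy : y ∈ annulus N ρ) :
    IsPoleFamily ρ (fun i => ρ ^ ((N - 2) * (i + 1))) (fun i => ρ ^ (2 * (i + 1)))
      (fun _ => 1) y := by
  refine ⟨summable_pow_mul_succ (by omega) hρ0 hρ1, fun i => by positivity, fun i => by positivity,
    fun i => pow_le_one₀ hρ0.le hρ1.le, fun i => by positivity, fun i => by linarith [hy.2],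
    ‖y‖ - ρ, sub_pos.2 hy.1, fun x _ hx1 i => ?_⟩
  refine le_trans ?_ (sub_le_norm_smul_sub_smul' (by positivity) zero_le_one x y)
  have := mul_le_of_le_one_right (by positivity : 0 ≤ ρ ^ (2 * (i + 1))) hx1
  nlinarith [pow_two_mul_succ_le hρ0 hρ1 i]

theorem isPoleFamily_inner (hN : 3 ≤ N) (hρ0 : 0 < ρ) (hρ1 : ρ < 1) (hy : y ∈ annulus N ρ) :
    IsPoleFamily ρ (fun i => ρ ^ ((N - 2) * (i + 1))) (fun _ => ‖y‖)
      (fun i => ρ ^ (2 * (i + 1)) / ‖y‖) y := by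
  have hr : 0 < ‖y‖ := hρ0.trans hy.1
  have hβ : ∀ i : ℕ, ρ ^ (2 * (i + 1)) / ‖y‖ * ‖y‖ = ρ ^ (2 * (i + 1)) := fun i =>
    div_mul_cancel₀ _ hr.ne'
  refine ⟨summable_pow_mul_succ (by omega) hρ0 hρ1, fun i => by positivity, fun i => by positivity,
    fun i => hy.2.le, fun i => by positivity, fun i => ?_,
    ρ * (‖y‖ - ρ), mul_pos hρ0 (sub_pos.2 hy.1), fun x hx _ i => ?_⟩
  · rw [hβ]; exact pow_le_one₀ hρ0.le hρ1.le
  · refine le_trans ?_ (sub_le_norm_smul_sub_smul (by positivity) (by positivity) x y)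
    rw [hβ]
    nlinarith [pow_two_mul_succ_le hρ0 hρ1 i]

theorem isPoleFamily_inner' (hN : 3 ≤ N) (hρ0 : 0 < ρ) (hρ1 : ρ < 1) (hy : y ∈ annulus N ρ) :
    IsPoleFamily ρ (fun i => ρ ^ ((N - 2) * (i + 1))) (fun _ => 1)
      (fun i => ρ ^ (2 * (i + 1))) y := by
  have hβ : ∀ i : ℕ, ρ ^ (2 * (i + 1)) * ‖y‖ ≤ ρ ^ (2 * (i + 1)) := fun i =>
    mul_le_of_le_one_right (by positivity) hy.2.le
  refine ⟨summable_pow_mul_succ (by omega) hρ0 hρ1, fun i => by positivity, fun i => by positivity,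
    fun i => le_rfl, fun i => by positivity,
    fun i => (hβ i).trans (pow_le_one₀ hρ0.le hρ1.le),
    ρ * (1 - ρ), mul_pos hρ0 (sub_pos.2 hρ1), fun x hx _ i => ?_⟩
  refine le_trans ?_ (sub_le_norm_smul_sub_smul (by positivity) (by positivity) x y)
  nlinarith [pow_two_mul_succ_le hρ0 hρ1 i, hβ i]

/-- The regular part of the Green function of the annulus, up to a constant factor, by the method
of images. -/
def imageSeries (N : ℕ) (ρ : ℝ) (x y : EuclideanSpace ℝ (Fin N)) : ℝ :=
  poleSeries (fun i => ρ ^ ((N - 2) * i)) (fun i => ‖y‖ * ρ ^ (2 * i)) (fun _ => 1 / ‖y‖) x y -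
  poleSeries (fun i => ρ ^ ((N - 2) * (i + 1))) (fun i => ρ ^ (2 * (i + 1))) (fun _ => 1) x y +
  poleSeries (fun i => ρ ^ ((N - 2) * (i + 1))) (fun _ => ‖y‖) (fun i => ρ ^ (2 * (i + 1)) / ‖y‖)
    x y -
  poleSeries (fun i => ρ ^ ((N - 2) * (i + 1))) (fun _ => 1) (fun i => ρ ^ (2 * (i + 1))) x y

theorem normSqPow_smul_sub_smul (p α β : ℝ) (x y : EuclideanSpace ℝ (Fin N)) :
    normSqPow p (α • x + (-β) • y) =
      (α ^ 2 * ‖x‖ ^ 2 - 2 * α * β * inner ℝ x y + β ^ 2 * ‖y‖ ^ 2) ^ p := by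
  rw [normSqPow, norm_sq_smul_sub_smul]

theorem normSqPow_sub (p : ℝ) (x y : EuclideanSpace ℝ (Fin N)) :
    normSqPow p (x - y) = (‖x‖ ^ 2 - 2 * inner ℝ x y + ‖y‖ ^ 2) ^ p := by
  have := normSqPow_smul_sub_smul p 1 1 x y
  simpa [sub_eq_add_neg] using this

/-- `c ^ (N-2) * (c² q) ^ (1 - N/2) = q ^ (1 - N/2)`. -/
theorem pow_mul_sq_mul_rpow (hN : 3 ≤ N) {c : ℝ} (hc : 0 < c) {q : ℝ} (hq : 0 ≤ q) :
    c ^ (N - 2) * (c ^ 2 * q) ^ (1 - (N : ℝ) / 2) = q ^ (1 - (N : ℝ) / 2) := by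
  rw [Real.mul_rpow (by positivity) hq, one_sub_half_eq, sq_rpow_neg_half hN hc.le, ← mul_assoc,
    mul_one_div_cancel (by positivity), one_mul]

/-- On the unit sphere reflection preserves the normalised distances: outer term `i + 1` cancels the
last family's term `i`, the two middle families cancel term by term, and outer term `0` is left. -/
theorem imageSeries_of_norm_eq_one (hN : 3 ≤ N) (hρ0 : 0 < ρ) (hρ1 : ρ < 1)
    (hy : y ∈ annulus N ρ) {x : EuclideanSpace ℝ (Fin N)} (hx : ‖x‖ = 1) :
    imageSeries N ρ x y = normSqPow (1 - (N : ℝ) / 2) (x - y) := by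
  have hr : 0 < ‖y‖ := hρ0.trans hy.1
  have ha := (isPoleFamily_outer hN hρ0 hρ1 hy).summable_pole (by linarith) hx.le
  simp only [imageSeries, poleSeries]
  rw [ha.tsum_eq_zero_add]
  simp only [normSqPow_smul_sub_smul, normSqPow_sub, hx]
  have h0 : (‖y‖ * ρ ^ (2 * 0)) ^ 2 * 1 ^ 2 - 2 * (‖y‖ * ρ ^ (2 * 0)) * (1 / ‖y‖) * inner ℝ x y +
      (1 / ‖y‖) ^ 2 * ‖y‖ ^ 2 = 1 ^ 2 - 2 * inner ℝ x y + ‖y‖ ^ 2 := by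
    field_simp; ring
  have h1 : ∀ i : ℕ, (‖y‖ * ρ ^ (2 * (i + 1))) ^ 2 * 1 ^ 2 -
      2 * (‖y‖ * ρ ^ (2 * (i + 1))) * (1 / ‖y‖) * inner ℝ x y + (1 / ‖y‖) ^ 2 * ‖y‖ ^ 2 =
      1 ^ 2 * 1 ^ 2 - 2 * 1 * ρ ^ (2 * (i + 1)) * inner ℝ x y +
        (ρ ^ (2 * (i + 1))) ^ 2 * ‖y‖ ^ 2 := fun i => by
    field_simp; ring
  have h2 : ∀ i : ℕ, (ρ ^ (2 * (i + 1))) ^ 2 * 1 ^ 2 - 2 * ρ ^ (2 * (i + 1)) * 1 * inner ℝ x y +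
      1 ^ 2 * ‖y‖ ^ 2 = ‖y‖ ^ 2 * 1 ^ 2 - 2 * ‖y‖ * (ρ ^ (2 * (i + 1)) / ‖y‖) * inner ℝ x y +
        (ρ ^ (2 * (i + 1)) / ‖y‖) ^ 2 * ‖y‖ ^ 2 := fun i => by
    field_simp; ring
  simp only [h0, h1, h2]
  simp

/-- On the inner sphere the pairing is shifted: the first family cancels the fourth, term `i + 1` of
the third cancels term `i` of the second, and term `0` of the third is left. -/
theorem imageSeries_of_norm_eq (hN : 3 ≤ N) (hρ0 : 0 < ρ) (hρ1 : ρ < 1)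
    (hy : y ∈ annulus N ρ) {x : EuclideanSpace ℝ (Fin N)} (hx : ‖x‖ = ρ) :
    imageSeries N ρ x y = normSqPow (1 - (N : ℝ) / 2) (x - y) := by
  have hr : 0 < ‖y‖ := hρ0.trans hy.1
  have hc := (isPoleFamily_inner hN hρ0 hρ1 hy).summable_pole hx.ge (by linarith)
  simp only [imageSeries, poleSeries]
  rw [hc.tsum_eq_zero_add]
  have hq : ∀ (α β : ℝ), 0 ≤ α ^ 2 * ρ ^ 2 - 2 * α * β * inner ℝ x y + β ^ 2 * ‖y‖ ^ 2 :=
    fun α β => by rw [← hx, ← norm_sq_smul_sub_smul]; positivity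
  simp only [normSqPow_smul_sub_smul, normSqPow_sub, hx]
  have h0 : ρ ^ ((N - 2) * (0 + 1)) * (‖y‖ ^ 2 * ρ ^ 2 -
      2 * ‖y‖ * (ρ ^ (2 * (0 + 1)) / ‖y‖) * inner ℝ x y +
        (ρ ^ (2 * (0 + 1)) / ‖y‖) ^ 2 * ‖y‖ ^ 2) ^ (1 - (N : ℝ) / 2) =
      (ρ ^ 2 - 2 * inner ℝ x y + ‖y‖ ^ 2) ^ (1 - (N : ℝ) / 2) := by
    simp only [zero_add, mul_one]
    rw [← pow_mul_sq_mul_rpow hN hρ0 (q := ρ ^ 2 - 2 * inner ℝ x y + ‖y‖ ^ 2)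
      (by simpa using hq 1 1)]
    congr 2
    field_simp
    ring
  have h1 : ∀ i : ℕ, ρ ^ ((N - 2) * (i + 1)) *
      (1 ^ 2 * ρ ^ 2 - 2 * 1 * ρ ^ (2 * (i + 1)) * inner ℝ x y +
        (ρ ^ (2 * (i + 1))) ^ 2 * ‖y‖ ^ 2) ^ (1 - (N : ℝ) / 2) =
      ρ ^ ((N - 2) * i) * ((‖y‖ * ρ ^ (2 * i)) ^ 2 * ρ ^ 2 -
        2 * (‖y‖ * ρ ^ (2 * i)) * (1 / ‖y‖) * inner ℝ x y +
          (1 / ‖y‖) ^ 2 * ‖y‖ ^ 2) ^ (1 - (N : ℝ) / 2) := fun i => by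
    rw [← pow_mul_sq_mul_rpow hN hρ0 (hq (‖y‖ * ρ ^ (2 * i)) (1 / ‖y‖)), ← mul_assoc, ← pow_add]
    congr 2
    field_simp; ring
  have h2 : ∀ i : ℕ, ρ ^ ((N - 2) * (i + 1 + 1)) * (‖y‖ ^ 2 * ρ ^ 2 -
      2 * ‖y‖ * (ρ ^ (2 * (i + 1 + 1)) / ‖y‖) * inner ℝ x y +
        (ρ ^ (2 * (i + 1 + 1)) / ‖y‖) ^ 2 * ‖y‖ ^ 2) ^ (1 - (N : ℝ) / 2) =
      ρ ^ ((N - 2) * (i + 1)) * ((ρ ^ (2 * (i + 1))) ^ 2 * ρ ^ 2 -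
        2 * ρ ^ (2 * (i + 1)) * 1 * inner ℝ x y + 1 ^ 2 * ‖y‖ ^ 2) ^ (1 - (N : ℝ) / 2) :=
    fun i => by
    rw [← pow_mul_sq_mul_rpow hN hρ0 (hq (ρ ^ (2 * (i + 1))) 1), ← mul_assoc, ← pow_add]
    congr 2
    field_simp; ring
  simp only [h0, h1, h2]
  ring

theorem isCorrector_imageSeries (hN : 3 ≤ N) (hρ0 : 0 < ρ) (hρ1 : ρ < 1) (hy : y ∈ annulus N ρ) :
    IsCorrector (annulus N ρ) y
      (fun x => 1 / (sphereArea N * ((N : ℝ) - 2)) * imageSeries N ρ x y) := by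
  have ha := isPoleFamily_outer hN hρ0 hρ1 hy
  have hb := isPoleFamily_outer' hN hρ0 hρ1 hy
  have hc := isPoleFamily_inner hN hρ0 hρ1 hy
  have hd := isPoleFamily_inner' hN hρ0 hρ1 hy
  refine ⟨?_, ?_, fun x hx => ?_⟩
  · exact (((ha.harmonicOnNhd.sub hb.harmonicOnNhd).add hc.harmonicOnNhd).sub
      hd.harmonicOnNhd).const_smul
  · exact continuousOn_const.mul
      (((ha.continuousOn.sub hb.continuousOn).add hc.continuousOn).sub hd.continuousOn)
  · rw [fundamentalSolution_eq hN]
    refine congrArg (1 / (sphereArea N * ((N : ℝ) - 2)) * ·) ?_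
    rcases norm_of_mem_frontier_annulus hx with h | h
    · exact imageSeries_of_norm_eq hN hρ0 hρ1 hy h
    · exact imageSeries_of_norm_eq_one hN hρ0 hρ1 hy h

end Images

/-! ### Uniqueness of the corrector, sign of the Green function, values on a sphere. -/

theorem harmonicOnNhd_normSqPow_sub {E : Type*} [NormedAddCommGroup E] [InnerProductSpace ℝ E]
    [FiniteDimensional ℝ E] {ι : Type*} [Fintype ι] (v : OrthonormalBasis ι ℝ E) (y : E) :
    InnerProductSpace.HarmonicOnNhd
      (fun x => normSqPow (1 - (Fintype.card ι : ℝ) / 2) (x - y)) {y}ᶜ := by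
  set p : ℝ := 1 - (Fintype.card ι : ℝ) / 2
  have hne : ∀ x ∈ ({y}ᶜ : Set E), x - y ≠ 0 := fun x hx => sub_ne_zero.2 hx
  refine harmonicOnNhd_of_hasFDerivAt (F' := fun x => normSqPowDeriv p (x - y))
    (F'' := fun x => normSqPowDeriv₂ p (x - y)) isOpen_compl_singleton ?_ ?_ ?_ v ?_
  · intro x hx
    exact (hasFDerivAt_normSqPow p (hne x hx)).comp (f := fun x => x - y) x
      ((hasFDerivAt_id x).sub_const y)
  · intro x hx
    exact (hasFDerivAt_normSqPowDeriv p (hne x hx)).comp (f := fun x => x - y) x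
      ((hasFDerivAt_id x).sub_const y)
  · exact (continuousOn_normSqPowDeriv₂ p).comp (by fun_prop) hne
  · exact fun x hx => trace_normSqPowDeriv₂ v _ (hne x hx)

section Green

variable {N : ℕ} {ρ : ℝ}

/-- Used in both directions, this gives uniqueness, so the corrector chosen in `regularPart` must be
the image series. -/
theorem IsCorrector.le (hN : 3 ≤ N) {y : EuclideanSpace ℝ (Fin N)}
    {u v : EuclideanSpace ℝ (Fin N) → ℝ} (hu : IsCorrector (annulus N ρ) y u)
    (hv : IsCorrector (annulus N ρ) y v) {x : EuclideanSpace ℝ (Fin N)}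
    (hx : x ∈ closure (annulus N ρ)) : u x ≤ v x := by
  have := nontrivial_euclideanSpace hN
  have h := nonneg_of_harmonicAt_of_nonneg (isCompact_closure_annulus N ρ) (u := v - u)
    (hv.2.1.sub hu.2.1) (fun z hz => ?_) hx
  · simpa using h
  · by_cases hz' : z ∈ annulus N ρ
    · exact Or.inr ⟨interior_maximal subset_closure (isOpen_annulus N ρ) hz',
        (hv.1 z hz').sub (hu.1 z hz')⟩
    · have hf : z ∈ frontier (annulus N ρ) := by
        rw [(isOpen_annulus N ρ).frontier_eq]; exact ⟨hz, hz'⟩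
      left
      simp [hu.2.2 z hf, hv.2.2 z hf]

theorem regularPart_annulus (hN : 3 ≤ N) (hρ0 : 0 < ρ) (hρ1 : ρ < 1)
    {x y : EuclideanSpace ℝ (Fin N)} (hx : x ∈ annulus N ρ) (hy : y ∈ annulus N ρ) :
    regularPart (annulus N ρ) x y = 1 / (sphereArea N * ((N : ℝ) - 2)) * imageSeries N ρ x y := by
  have h := isCorrector_imageSeries hN hρ0 hρ1 hy
  have hex : ∃ u, IsCorrector (annulus N ρ) y u := ⟨_, h⟩
  rw [regularPart, dif_pos hex]
  exact le_antisymm (hex.choose_spec.le hN h (subset_closure hx))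
    (h.le hN hex.choose_spec (subset_closure hx))

/-- This is `G ≥ 0`: the difference vanishes on the boundary and is nonnegative near the pole, so
the minimum principle applies outside a small ball. -/
theorem imageSeries_le (hN : 3 ≤ N) (hρ0 : 0 < ρ) (hρ1 : ρ < 1)
    {x y : EuclideanSpace ℝ (Fin N)} (hx : x ∈ annulus N ρ) (hy : y ∈ annulus N ρ) (hxy : x ≠ y) :
    imageSeries N ρ x y ≤ normSqPow (1 - (N : ℝ) / 2) (x - y) := by
  have := nontrivial_euclideanSpace hN
  have ha := isPoleFamily_outer hN hρ0 hρ1 hy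
  have hb := isPoleFamily_outer' hN hρ0 hρ1 hy
  have hc := isPoleFamily_inner hN hρ0 hρ1 hy
  have hd := isPoleFamily_inner' hN hρ0 hρ1 hy
  have hcont : ContinuousOn (fun x => imageSeries N ρ x y) (closure (annulus N ρ)) :=
    ((ha.continuousOn.sub hb.continuousOn).add hc.continuousOn).sub hd.continuousOn
  have hharm : InnerProductSpace.HarmonicOnNhd (fun x => imageSeries N ρ x y) (annulus N ρ) :=
    ((ha.harmonicOnNhd.sub hb.harmonicOnNhd).add hc.harmonicOnNhd).sub hd.harmonicOnNhd
  have hK := harmonicOnNhd_normSqPow_sub (EuclideanSpace.basisFun (Fin N) ℝ) y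
  rw [Fintype.card_fin] at hK
  obtain ⟨M, hM⟩ := (isCompact_closure_annulus N ρ).exists_bound_of_continuousOn hcont
  have hM0 : 0 ≤ M := (norm_nonneg _).trans (hM x (subset_closure hx))
  -- The first bound keeps `x` outside the removed ball; the second makes the kernel exceed the
  -- bound `M` of the image series on its boundary.
  set δ : ℝ := min ‖x - y‖ (1 / (M + 1)) with hδ
  have hδ0 : 0 < δ := lt_min (norm_pos_iff.2 (sub_ne_zero.2 hxy)) (by positivity)
  have hδM : δ ≤ 1 / (M + 1) := min_le_right _ _
  have hδ1 : δ ≤ 1 := hδM.trans (by rw [div_le_one (by positivity)]; linarith)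
  have hδpow : M ≤ 1 / δ ^ (N - 2) := by
    have h1 : δ ^ (N - 2) ≤ 1 / (M + 1) :=
      (pow_le_of_le_one hδ0.le hδ1 (by omega)).trans hδM
    have h2 := one_div_le_one_div_of_le (by positivity) h1
    rw [one_div_one_div] at h2
    linarith
  have hS : IsCompact (closure (annulus N ρ) \ Metric.ball y δ) :=
    (isCompact_closure_annulus N ρ).diff Metric.isOpen_ball
  have h := nonneg_of_harmonicAt_of_nonneg hS
    (u := (fun x => normSqPow (1 - (N : ℝ) / 2) (x - y)) - fun x => imageSeries N ρ x y)
    ((hK.continuousOn.mono ?_).sub (hcont.mono sdiff_subset)) (fun z hz => ?_)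
    (x := x) ⟨subset_closure hx, ?_⟩
  · simpa using h
  · rintro z ⟨_, hz⟩ (rfl : z = y)
    simp [hδ0] at hz
  · have hzδ : δ ≤ ‖z - y‖ := by simpa [dist_eq_norm] using hz.2
    by_cases hz' : z ∈ annulus N ρ
    · rcases hzδ.eq_or_lt with heq | hlt
      · left
        have h1 := (le_abs_self _).trans (hM z hz.1)
        have h2 : normSqPow (1 - (N : ℝ) / 2) (z - y) = 1 / δ ^ (N - 2) := by
          rw [normSqPow, one_sub_half_eq, sq_rpow_neg_half hN (norm_nonneg _), heq]
        simp only [Pi.sub_apply, h2]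
        linarith
      · refine Or.inr ⟨?_, (hK z ?_).sub (hharm z hz')⟩
        · refine mem_interior.2 ⟨annulus N ρ ∩ {z | δ < ‖z - y‖}, ?_, ?_, hz', hlt⟩
          · rintro w ⟨hw, hw'⟩
            exact ⟨subset_closure hw, by simpa [dist_eq_norm] using (le_of_lt hw')⟩
          · exact (isOpen_annulus N ρ).inter (isOpen_lt continuous_const (by fun_prop))
        · rintro (rfl : z = y)
          simp at hlt
          linarith
    · have hf : z ∈ frontier (annulus N ρ) := by
        rw [(isOpen_annulus N ρ).frontier_eq]; exact ⟨hz.1, hz'⟩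
      left
      rcases norm_of_mem_frontier_annulus hf with h | h
      · simp [imageSeries_of_norm_eq hN hρ0 hρ1 hy h]
      · simp [imageSeries_of_norm_eq_one hN hρ0 hρ1 hy h]
  · simp [dist_eq_norm, hδ]

/-- The series `∑ (ρ^i v)^(N-2) (1 - 2 (ρ^i v)² t + (ρ^i v)⁴)^(1-N/2)`. -/
def scaleSeries (N : ℕ) (ρ t v : ℝ) : ℝ :=
  ∑' i : ℕ, (ρ ^ i * v) ^ (N - 2) *
    (1 - 2 * (ρ ^ i * v) ^ 2 * t + ((ρ ^ i * v) ^ 2) ^ 2) ^ (1 - (N : ℝ) / 2)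

theorem quadratic_nonneg {t : ℝ} (ht1 : -1 ≤ t) (ht2 : t ≤ 1) (u : ℝ) :
    0 ≤ 1 - 2 * u * t + u ^ 2 := by
  nlinarith [sq_nonneg (u - t)]

/-- The regular part at two points on the same sphere. -/
theorem pow_mul_imageSeries (hN : 3 ≤ N) (hρ0 : 0 < ρ) {r t : ℝ} (hr : 0 < r)
    {x y : EuclideanSpace ℝ (Fin N)} (hx : ‖x‖ = r) (hy : ‖y‖ = r) (ht : inner ℝ x y = r ^ 2 * t) :
    r ^ (N - 2) * imageSeries N ρ x y =
      scaleSeries N ρ t r - 2 * scaleSeries N ρ t ρ + scaleSeries N ρ t (ρ / r) := by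
  have habs : |r ^ 2 * t| ≤ r * r := by
    rw [← ht]
    calc |inner ℝ x y| ≤ ‖x‖ * ‖y‖ := abs_real_inner_le_norm x y
      _ = r * r := by rw [hx, hy]
  have hr2 : 0 < r ^ 2 := by positivity
  obtain ⟨hl, hu⟩ := abs_le.1 habs
  have ht1 : -1 ≤ t := by nlinarith
  have ht2 : t ≤ 1 := by nlinarith
  simp only [imageSeries, poleSeries, scaleSeries, normSqPow_smul_sub_smul, hx, hy, ht]
  -- The first family becomes the series at `r`, the second and fourth the series at `ρ`, the third
  -- the series at `ρ/r`.
  have e1 : ∀ i : ℕ, (ρ ^ i * r) ^ (N - 2) *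
      (1 - 2 * (ρ ^ i * r) ^ 2 * t + ((ρ ^ i * r) ^ 2) ^ 2) ^ (1 - (N : ℝ) / 2) =
      r ^ (N - 2) * (ρ ^ ((N - 2) * i) * ((r * ρ ^ (2 * i)) ^ 2 * r ^ 2 -
        2 * (r * ρ ^ (2 * i)) * (1 / r) * (r ^ 2 * t) + (1 / r) ^ 2 * r ^ 2) ^
          (1 - (N : ℝ) / 2)) := fun i => by
    rw [mul_pow, mul_comm (N - 2) i, pow_mul ρ i, ← mul_assoc, mul_comm (r ^ (N - 2))]
    congr 2
    field_simp
    ring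
  have e2 : ∀ i : ℕ, (ρ ^ i * ρ) ^ (N - 2) *
      (1 - 2 * (ρ ^ i * ρ) ^ 2 * t + ((ρ ^ i * ρ) ^ 2) ^ 2) ^ (1 - (N : ℝ) / 2) =
      r ^ (N - 2) * (ρ ^ ((N - 2) * (i + 1)) * ((ρ ^ (2 * (i + 1))) ^ 2 * r ^ 2 -
        2 * ρ ^ (2 * (i + 1)) * 1 * (r ^ 2 * t) + 1 ^ 2 * r ^ 2) ^ (1 - (N : ℝ) / 2)) :=
    fun i => by
    rw [← pow_succ, ← pow_mul_sq_mul_rpow hN hr (quadratic_nonneg ht1 ht2 _),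
      mul_comm (N - 2) (i + 1), pow_mul ρ (i + 1), mul_left_comm]
    congr 3
    ring
  have e3 : ∀ i : ℕ, (ρ ^ i * (ρ / r)) ^ (N - 2) *
      (1 - 2 * (ρ ^ i * (ρ / r)) ^ 2 * t + ((ρ ^ i * (ρ / r)) ^ 2) ^ 2) ^ (1 - (N : ℝ) / 2) =
      r ^ (N - 2) * (ρ ^ ((N - 2) * (i + 1)) * (r ^ 2 * r ^ 2 -
        2 * r * (ρ ^ (2 * (i + 1)) / r) * (r ^ 2 * t) + (ρ ^ (2 * (i + 1)) / r) ^ 2 * r ^ 2) ^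
          (1 - (N : ℝ) / 2)) := fun i => by
    rw [← mul_div_assoc, ← pow_succ, ← pow_mul_sq_mul_rpow hN hr2 (quadratic_nonneg ht1 ht2 _),
      div_pow, mul_comm (N - 2) (i + 1), pow_mul ρ (i + 1), ← pow_mul r 2 (N - 2),
      mul_comm 2 (N - 2), pow_mul r (N - 2) 2]
    have h1 : (r ^ 2) ^ 2 * (1 - 2 * (ρ ^ (i + 1) / r) ^ 2 * t + ((ρ ^ (i + 1) / r) ^ 2) ^ 2) =
        r ^ 2 * r ^ 2 - 2 * r * (ρ ^ (2 * (i + 1)) / r) * (r ^ 2 * t) +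
          (ρ ^ (2 * (i + 1)) / r) ^ 2 * r ^ 2 := by
      field_simp
      ring
    rw [h1]
    have h2 : r ^ (N - 2) ≠ 0 := by positivity
    field_simp
  have e4 : ∀ i : ℕ, (ρ ^ i * ρ) ^ (N - 2) *
      (1 - 2 * (ρ ^ i * ρ) ^ 2 * t + ((ρ ^ i * ρ) ^ 2) ^ 2) ^ (1 - (N : ℝ) / 2) =
      r ^ (N - 2) * (ρ ^ ((N - 2) * (i + 1)) * (1 ^ 2 * r ^ 2 -
        2 * 1 * ρ ^ (2 * (i + 1)) * (r ^ 2 * t) + (ρ ^ (2 * (i + 1))) ^ 2 * r ^ 2) ^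
          (1 - (N : ℝ) / 2)) := fun i => by
    rw [e2]
    congr 3
    ring
  have f1 := (tsum_congr (L := .unconditional ℕ) e1).trans tsum_mul_left
  have f2 := (tsum_congr (L := .unconditional ℕ) e2).trans tsum_mul_left
  have f3 := (tsum_congr (L := .unconditional ℕ) e3).trans tsum_mul_left
  have f4 := (tsum_congr (L := .unconditional ℕ) e4).trans tsum_mul_left
  linear_combination -f1 + f2 + f4 - f3

end Green

/-! ### Least eigenvalue of a matrix with constant row sums. -/

/-- A matrix with constant row sums and nonpositive off-diagonal entries has the row sum as its
least eigenvalue. -/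
theorem firstEigenvalue_eq_of_row_sum {k : ℕ} (hk : 0 < k) {M : Matrix (Fin k) (Fin k) ℝ} {c : ℝ}
    (hrow : ∀ i, ∑ j, M i j = c) (hoff : ∀ i j, i ≠ j → M i j ≤ 0) : firstEigenvalue M = c := by
  have : Nonempty (Fin k) := ⟨⟨0, hk⟩⟩
  refine IsLeast.csInf_eq ⟨?_, fun μ hμ => ?_⟩
  · refine Module.End.hasEigenvalue_of_hasEigenvector (x := fun _ => 1)
      (Module.End.hasEigenvector_iff.2 ⟨Module.End.mem_eigenspace_iff.2 ?_, ?_⟩)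
    · ext i
      simp [Matrix.toLin'_apply, Matrix.mulVec, dotProduct, hrow i]
    · intro h
      have := congrFun h ⟨0, hk⟩
      simp at this
  · obtain ⟨v, hv⟩ := Module.End.HasEigenvalue.exists_hasEigenvector hμ
    have hvM : Matrix.mulVec M v = μ • v := by
      simpa [Matrix.toLin'_apply] using hv.apply_eq_smul
    -- At an entry of largest modulus all ratios `v j / v i` are at most `1`, so nonpositive
    -- off-diagonal entries can only raise row `i` above its row sum.
    obtain ⟨i, hi⟩ := Finite.exists_max fun i => |v i|
    have hi0 : v i ≠ 0 := by
      intro h0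
      apply hv.2
      ext j
      have := hi j
      rw [h0, abs_zero] at this
      exact abs_eq_zero.1 (le_antisymm this (abs_nonneg _))
    have h1 : ∑ j, M i j * (v j / v i) = μ := by
      have := congrFun hvM i
      simp only [Matrix.mulVec, dotProduct, Pi.smul_apply, smul_eq_mul] at this
      simp only [← mul_div_assoc]
      rw [← Finset.sum_div, this, mul_div_cancel_right₀ _ hi0]
    rw [← h1, ← hrow i]
    refine Finset.sum_le_sum fun j _ => ?_
    by_cases hij : i = j
    · subst hij
      simp [hi0]
    · have h2 : v j / v i ≤ 1 := by
        refine (le_abs_self _).trans ?_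
        rw [abs_div]
        exact div_le_one_of_le₀ (hi j) (abs_nonneg _)
      nlinarith [hoff i j hij]

theorem sum_cos_sub {k : ℕ} (g : ℝ → ℝ) (i : Fin k) :
    ∑ j : Fin k, g (Real.cos (2 * Real.pi * ((i : ℕ) : ℝ) / k - 2 * Real.pi * ((j : ℕ) : ℝ) / k)) =
      ∑ j ∈ Finset.range k, g (Real.cos (2 * Real.pi * (j : ℝ) / k)) := by
  have : NeZero k := ⟨fun h => by subst h; exact i.elim0⟩
  have hk : (k : ℝ) ≠ 0 := by exact_mod_cast NeZero.ne k
  rw [← Fin.sum_univ_eq_sum_range fun j => g (Real.cos (2 * Real.pi * (j : ℝ) / k))]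
  refine Fintype.sum_equiv (Equiv.subLeft i) _ _ fun j => ?_
  congr 1
  simp only [Equiv.subLeft_apply]
  rcases le_or_gt j i with hji | hij
  · rw [Fin.sub_val_of_le hji, Nat.cast_sub (by exact_mod_cast hji)]
    congr 1
    ring
  -- Subtraction in `Fin k` wraps around, which shifts the angle by `2π`.
  · have hval : ((i - j : Fin k) : ℕ) = k - j + i := by
      rw [Fin.val_sub, Nat.mod_eq_of_lt]
      have := j.2
      have : (i : ℕ) < j := hij
      omega
    rw [hval, Nat.cast_add, Nat.cast_sub j.2.le, ← Real.cos_add_two_pi]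
    congr 1
    field_simp
    ring

/-! ### The interaction matrix of the regular polygon. -/

section Polygon

variable {N k : ℕ}

theorem inner_polygonPoint (hN : 3 ≤ N) (r : ℝ) (i j : Fin k) :
    inner ℝ (polygonPoint N k r i) (polygonPoint N k r j) =
      r ^ 2 * Real.cos (2 * Real.pi * ((i : ℕ) : ℝ) / k - 2 * Real.pi * ((j : ℕ) : ℝ) / k) := by
  obtain ⟨M, rfl⟩ : ∃ M, N = M + 2 := ⟨N - 2, by omega⟩
  rw [PiLp.inner_apply, Fin.sum_univ_succ, Fin.sum_univ_succ, Real.cos_sub]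
  simp [polygonPoint]
  ring

theorem norm_polygonPoint (hN : 3 ≤ N) {r : ℝ} (hr : 0 < r) (i : Fin k) :
    ‖polygonPoint N k r i‖ = r := by
  have h := inner_polygonPoint hN r i i
  rw [real_inner_self_eq_norm_sq, sub_self, Real.cos_zero, mul_one] at h
  exact (pow_left_inj₀ (norm_nonneg _) hr.le two_ne_zero).1 h

theorem polygonPoint_mem_annulus (hN : 3 ≤ N) {ρ r : ℝ} (hρ0 : 0 < ρ) (hr : r ∈ Ioo ρ 1)
    (i : Fin k) : polygonPoint N k r i ∈ annulus N ρ := by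
  rw [annulus, mem_ofPred_eq, norm_polygonPoint hN (hρ0.trans hr.1)]
  exact hr

theorem cos_sub_lt_one {i j : Fin k} (hij : i ≠ j) :
    Real.cos (2 * Real.pi * ((i : ℕ) : ℝ) / k - 2 * Real.pi * ((j : ℕ) : ℝ) / k) < 1 := by
  have hk : (0 : ℝ) < k := by exact_mod_cast i.pos
  refine lt_of_le_of_ne (Real.cos_le_one _) fun h => ?_
  have hi : ((i : ℕ) : ℝ) < k := by exact_mod_cast i.2
  have hj : ((j : ℕ) : ℝ) < k := by exact_mod_cast j.2
  have hi0 : (0 : ℝ) ≤ ((i : ℕ) : ℝ) := by positivity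
  have hj0 : (0 : ℝ) ≤ ((j : ℕ) : ℝ) := by positivity
  have e : 2 * Real.pi * ((i : ℕ) : ℝ) / k - 2 * Real.pi * ((j : ℕ) : ℝ) / k =
      2 * Real.pi * ((((i : ℕ) : ℝ) - ((j : ℕ) : ℝ)) / k) := by ring
  have h2 := (Real.cos_eq_one_iff_of_lt_of_lt (x := 2 * Real.pi *
    ((((i : ℕ) : ℝ) - ((j : ℕ) : ℝ)) / k)) ?_ ?_).1 (by rw [← e]; exact h)
  · have h3 : (((i : ℕ) : ℝ) - ((j : ℕ) : ℝ)) / k = 0 := by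
      simpa [Real.pi_ne_zero] using h2
    rw [div_eq_zero_iff, sub_eq_zero] at h3
    rcases h3 with h3 | h3
    · exact hij (Fin.ext (by exact_mod_cast h3))
    · exact hk.ne' h3
  · have : -1 < (((i : ℕ) : ℝ) - ((j : ℕ) : ℝ)) / k := by rw [lt_div_iff₀ hk]; linarith
    nlinarith [Real.pi_pos]
  · have : (((i : ℕ) : ℝ) - ((j : ℕ) : ℝ)) / k < 1 := by rw [div_lt_iff₀ hk]; linarith
    nlinarith [Real.pi_pos]

/-- The convention `0 ^ p = 0` for `p ≠ 0` drops the singular part on the diagonal, so one formula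
covers both the Robin and the Green entries. -/
theorem zero_rpow_one_sub_half (hN : 3 ≤ N) : (0 : ℝ) ^ (1 - (N : ℝ) / 2) = 0 := by
  have : (3 : ℝ) ≤ N := by exact_mod_cast hN
  exact Real.zero_rpow (by linarith)

/-- The scaled entry of the interaction matrix, as a function of the cosine of the angle. -/
def scaledEntry (N : ℕ) (ρ r t : ℝ) : ℝ :=
  scaleSeries N ρ t r - 2 * scaleSeries N ρ t ρ + scaleSeries N ρ t (ρ / r) -
    (2 - 2 * t) ^ (1 - (N : ℝ) / 2)

theorem interactionMatrix_polygon (hN : 3 ≤ N) {ρ r : ℝ} (hρ0 : 0 < ρ) (hρ1 : ρ < 1)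
    (hr : r ∈ Ioo ρ 1) (i j : Fin k) :
    interactionMatrix (annulus N ρ) (polygonPoint N k r) i j =
      1 / (sphereArea N * ((N : ℝ) - 2)) *
        (imageSeries N ρ (polygonPoint N k r i) (polygonPoint N k r j) -
          normSqPow (1 - (N : ℝ) / 2) (polygonPoint N k r i - polygonPoint N k r j)) := by
  have hi := polygonPoint_mem_annulus (k := k) hN hρ0 hr
  rw [interactionMatrix, Matrix.of_apply]
  split_ifs with h
  · subst h
    rw [robin, regularPart_annulus hN hρ0 hρ1 (hi i) (hi i), sub_self, normSqPow, norm_zero,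
      zero_pow two_ne_zero, zero_rpow_one_sub_half hN, sub_zero]
  · rw [green, regularPart_annulus hN hρ0 hρ1 (hi i) (hi j), fundamentalSolution_eq hN]
    ring

theorem pow_mul_interactionMatrix (hN : 3 ≤ N) {ρ r : ℝ} (hρ0 : 0 < ρ) (hρ1 : ρ < 1)
    (hr : r ∈ Ioo ρ 1) (i j : Fin k) :
    r ^ (N - 2) * interactionMatrix (annulus N ρ) (polygonPoint N k r) i j =
      1 / (sphereArea N * ((N : ℝ) - 2)) * scaledEntry N ρ r
        (Real.cos (2 * Real.pi * ((i : ℕ) : ℝ) / k - 2 * Real.pi * ((j : ℕ) : ℝ) / k)) := by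
  have hr0 : 0 < r := hρ0.trans hr.1
  set t := Real.cos (2 * Real.pi * ((i : ℕ) : ℝ) / k - 2 * Real.pi * ((j : ℕ) : ℝ) / k) with ht
  have hin := inner_polygonPoint hN r i j
  rw [← ht] at hin
  rw [interactionMatrix_polygon hN hρ0 hρ1 hr, mul_left_comm, mul_sub (r ^ (N - 2)),
    pow_mul_imageSeries hN hρ0 hr0 (norm_polygonPoint hN hr0 i) (norm_polygonPoint hN hr0 j) hin,
    normSqPow_sub, hin, norm_polygonPoint hN hr0, norm_polygonPoint hN hr0, scaledEntry]
  have ht1 : t ≤ 1 := Real.cos_le_one _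
  rw [← pow_mul_sq_mul_rpow hN hr0 (q := 2 - 2 * t) (by linarith)]
  congr 4
  ring

theorem interactionMatrix_nonpos (hN : 3 ≤ N) {ρ r : ℝ} (hρ0 : 0 < ρ) (hρ1 : ρ < 1)
    (hr : r ∈ Ioo ρ 1) {i j : Fin k} (hij : i ≠ j) :
    interactionMatrix (annulus N ρ) (polygonPoint N k r) i j ≤ 0 := by
  have hi := polygonPoint_mem_annulus (k := k) hN hρ0 hr
  rw [interactionMatrix_polygon hN hρ0 hρ1 hr]
  refine mul_nonpos_of_nonneg_of_nonpos (greenConst_pos hN).le (sub_nonpos.2 ?_)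
  refine imageSeries_le hN hρ0 hρ1 (hi i) (hi j) fun h => ?_
  have h1 := inner_polygonPoint hN r i j
  have hr0 : 0 < r := hρ0.trans hr.1
  rw [h, real_inner_self_eq_norm_sq, norm_polygonPoint hN hr0] at h1
  nlinarith [cos_sub_lt_one hij, pow_pos hr0 2]

theorem pow_mul_Lambda1 (hN : 3 ≤ N) (hk : 1 ≤ k) {ρ r : ℝ} (hρ0 : 0 < ρ) (hρ1 : ρ < 1)
    (hr : r ∈ Ioo ρ 1) :
    r ^ (N - 2) * Lambda1 N k ρ r = 1 / (sphereArea N * ((N : ℝ) - 2)) *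
      ∑ j ∈ Finset.range k, scaledEntry N ρ r (Real.cos (2 * Real.pi * (j : ℝ) / k)) := by
  have hr0 : 0 < r := hρ0.trans hr.1
  have hne : r ^ (N - 2) ≠ 0 := by positivity
  have h : Lambda1 N k ρ r = (1 / (sphereArea N * ((N : ℝ) - 2)) * ∑ j ∈ Finset.range k,
      scaledEntry N ρ r (Real.cos (2 * Real.pi * (j : ℝ) / k))) / r ^ (N - 2) := by
    refine firstEigenvalue_eq_of_row_sum hk (fun i => ?_)
      fun i j hij => interactionMatrix_nonpos hN hρ0 hρ1 hr hij
    rw [eq_div_iff hne, mul_comm, Finset.mul_sum]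
    simp only [pow_mul_interactionMatrix hN hρ0 hρ1 hr]
    rw [← Finset.mul_sum, sum_cos_sub (scaledEntry N ρ r) i]
  rw [h, mul_div_cancel₀ _ hne]

/-- Uses `2 - 2 cos 2x = (2 sin x)²`; the term `j = 0` is zero by the convention on `0 ^ p`. -/
theorem sum_rpow_eq_polygonConst (hN : 3 ≤ N) (hk : 1 ≤ k) :
    ∑ j ∈ Finset.range k, (2 - 2 * Real.cos (2 * Real.pi * (j : ℝ) / k)) ^ (1 - (N : ℝ) / 2) =
      polygonConst k N := by
  have hk0 : (0 : ℝ) < k := by exact_mod_cast hk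
  have hr : Finset.range k = insert 0 (Finset.Icc 1 (k - 1)) := by
    ext j; simp; omega
  rw [hr, Finset.sum_insert (by simp), polygonConst]
  have h0 : (2 - 2 * Real.cos (2 * Real.pi * ((0 : ℕ) : ℝ) / k)) ^ (1 - (N : ℝ) / 2) = 0 := by
    simp [zero_rpow_one_sub_half hN]
  rw [h0, zero_add]
  refine Finset.sum_congr rfl fun j hj => ?_
  obtain ⟨hj1, hj2⟩ := Finset.mem_Icc.1 hj
  have hjk : (j : ℝ) ≤ k := by exact_mod_cast (by omega : j ≤ k)
  have hs : 0 ≤ Real.sin (Real.pi * (j : ℝ) / k) := by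
    refine Real.sin_nonneg_of_nonneg_of_le_pi (by positivity) ?_
    rw [div_le_iff₀ hk0]
    exact mul_le_mul_of_nonneg_left hjk Real.pi_pos.le
  rw [one_sub_half_eq, ← sq_rpow_neg_half hN (by positivity)]
  congr 1
  have e : 2 * Real.pi * (j : ℝ) / k = 2 * (Real.pi * (j : ℝ) / k) := by ring
  rw [e, Real.cos_two_mul]
  linear_combination (-4) * Real.sin_sq_add_cos_sq (Real.pi * (j : ℝ) / k)

theorem polygonConst_pos (hk : 2 ≤ k) : 0 < polygonConst k N := by
  have hk0 : (0 : ℝ) < k := by exact_mod_cast (by omega : 0 < k)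
  refine Finset.sum_pos (fun j hj => ?_) ⟨1, Finset.mem_Icc.2 ⟨le_rfl, by omega⟩⟩
  obtain ⟨hj1, hj2⟩ := Finset.mem_Icc.1 hj
  have hjk : (j : ℝ) < k := by exact_mod_cast (by omega : j < k)
  have hj0 : (0 : ℝ) < j := by exact_mod_cast hj1
  have hs : 0 < Real.sin (Real.pi * (j : ℝ) / k) := by
    refine Real.sin_pos_of_pos_of_lt_pi (by positivity) ?_
    rw [div_lt_iff₀ hk0]
    exact mul_lt_mul_of_pos_left hjk Real.pi_pos
  positivity

theorem summable_scaleSeries (hN : 3 ≤ N) {ρ v t : ℝ} (hρ0 : 0 < ρ) (hρ1 : ρ < 1) (hv0 : 0 < v)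
    (hv1 : v < 1) (ht1 : -1 ≤ t) (ht2 : t ≤ 1) :
    Summable fun i : ℕ => (ρ ^ i * v) ^ (N - 2) *
      (1 - 2 * (ρ ^ i * v) ^ 2 * t + ((ρ ^ i * v) ^ 2) ^ 2) ^ (1 - (N : ℝ) / 2) := by
  have hN' : (3 : ℝ) ≤ N := by exact_mod_cast hN
  have hv2 : v ^ 2 < 1 := pow_lt_one₀ hv0.le hv1 two_ne_zero
  refine Summable.of_nonneg_of_le (fun i => ?_) (fun i => ?_)
    ((summable_pow_mul (n := N - 2) (by omega) hρ0 hρ1).mul_right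
      (((1 - v ^ 2) ^ 2) ^ (1 - (N : ℝ) / 2)))
  · exact mul_nonneg (by positivity) (Real.rpow_nonneg (quadratic_nonneg ht1 ht2 _) _)
  · have hle : ρ ^ i * v ≤ v := mul_le_of_le_one_left hv0.le (pow_le_one₀ hρ0.le hρ1.le)
    have hle2 : (ρ ^ i * v) ^ 2 ≤ v ^ 2 := pow_le_pow_left₀ (by positivity) hle 2
    refine mul_le_mul ?_ ?_ (Real.rpow_nonneg (quadratic_nonneg ht1 ht2 _) _) (by positivity)
    · rw [mul_pow, mul_comm (N - 2) i, pow_mul]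
      exact mul_le_of_le_one_right (by positivity) (pow_le_one₀ hv0.le hv1.le)
    · refine Real.rpow_le_rpow_of_nonpos (by nlinarith) ?_ (by linarith)
      have h1 : (1 - v ^ 2) ^ 2 ≤ (1 - (ρ ^ i * v) ^ 2) ^ 2 :=
        pow_le_pow_left₀ (by linarith) (by linarith) 2
      have h2 : (0 : ℝ) ≤ (ρ ^ i * v) ^ 2 * (1 - t) := mul_nonneg (by positivity) (by linarith)
      nlinarith

/-- The series `∑ α_m v^L / (1 - ρ^L)`, `L = 2m + N - 2`. -/
def radialSeries (N k : ℕ) (ρ v : ℝ) : ℝ :=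
  ∑' m : ℕ, alpha k m N * v ^ (2 * m + (N - 2)) / (1 - ρ ^ (2 * m + (N - 2)))

theorem summable_alpha_mul_pow (hN : 3 ≤ N) (hk : 1 ≤ k) {v : ℝ} (hv0 : 0 ≤ v) (hv1 : v < 1) :
    Summable fun m : ℕ => alpha k m N * v ^ (2 * m + (N - 2)) := by
  have hv2 : v ^ 2 < 1 := pow_lt_one₀ hv0 hv1 two_ne_zero
  have h := (hasSum_alpha hN hk (u := v ^ 2)
    (by rwa [abs_of_nonneg (by positivity)])).summable.mul_right (v ^ (N - 2))
  refine h.congr fun m => ?_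
  rw [pow_add, pow_mul, mul_assoc]

theorem one_sub_pow_bounds (hN : 3 ≤ N) {ρ : ℝ} (hρ0 : 0 < ρ) (hρ1 : ρ < 1) (m : ℕ) :
    1 - ρ ≤ 1 - ρ ^ (2 * m + (N - 2)) ∧ 1 - ρ ^ (2 * m + (N - 2)) ≤ 1 :=
  ⟨sub_le_sub_left (pow_le_of_le_one hρ0.le hρ1.le (by omega)) _,
    sub_le_self _ (by positivity)⟩

theorem summable_radialSeries (hN : 3 ≤ N) (hk : 1 ≤ k) {ρ v : ℝ} (hρ0 : 0 < ρ) (hρ1 : ρ < 1)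
    (hv0 : 0 ≤ v) (hv1 : v < 1) :
    Summable fun m : ℕ => alpha k m N * v ^ (2 * m + (N - 2)) / (1 - ρ ^ (2 * m + (N - 2))) := by
  refine Summable.of_nonneg_of_le (fun m => ?_) (fun m => ?_)
    ((summable_alpha_mul_pow hN hk hv0 hv1).mul_right (1 / (1 - ρ)))
  · have := (one_sub_pow_bounds hN hρ0 hρ1 m).1
    exact div_nonneg (mul_nonneg (alpha_nonneg hN hk m) (by positivity)) (by linarith)
  · rw [mul_one_div]
    exact div_le_div_of_nonneg_left (mul_nonneg (alpha_nonneg hN hk m) (by positivity))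
      (by linarith) (one_sub_pow_bounds hN hρ0 hρ1 m).1

/-- Expand each image in Gegenbauer modes and sum over the images first: mode `m` gives a geometric
series of ratio `ρ^L`. The exchange is legitimate because `α_m ≥ 0`. -/
theorem sum_scaleSeries (hN : 3 ≤ N) (hk : 1 ≤ k) {ρ v : ℝ} (hρ0 : 0 < ρ) (hρ1 : ρ < 1)
    (hv0 : 0 < v) (hv1 : v < 1) :
    ∑ j ∈ Finset.range k, scaleSeries N ρ (Real.cos (2 * Real.pi * (j : ℝ) / k)) v =
      radialSeries N k ρ v := by
  simp only [scaleSeries]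
  rw [← Summable.tsum_finsetSum fun j _ => summable_scaleSeries hN hρ0 hρ1 hv0 hv1
    (Real.neg_one_le_cos _) (Real.cos_le_one _)]
  have hgeom : ∀ m : ℕ, HasSum (fun i : ℕ => alpha k m N * (ρ ^ i * v) ^ (2 * m + (N - 2)))
      (alpha k m N * v ^ (2 * m + (N - 2)) / (1 - ρ ^ (2 * m + (N - 2)))) := fun m => by
    have := (hasSum_geometric_of_lt_one (r := ρ ^ (2 * m + (N - 2))) (by positivity)
      (pow_lt_one₀ hρ0.le hρ1 (by omega))).mul_left (alpha k m N * v ^ (2 * m + (N - 2)))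
    rw [← div_eq_mul_inv] at this
    convert! this using 1
    ext i
    rw [mul_pow, ← pow_mul, ← pow_mul, mul_comm i]
    ring
  have hprod : Summable (Function.uncurry fun m i : ℕ =>
      alpha k m N * (ρ ^ i * v) ^ (2 * m + (N - 2))) := by
    rw [summable_prod_of_nonneg]
    · refine ⟨fun m => (hgeom m).summable, ?_⟩
      refine (summable_radialSeries hN hk hρ0 hρ1 hv0.le hv1).congr fun m => ?_
      exact (hgeom m).tsum_eq.symm
    · exact fun x => mul_nonneg (alpha_nonneg hN hk _) (by positivity)
  rw [radialSeries, ← tsum_congr fun m => (hgeom m).tsum_eq, ← hprod.tsum_comm]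
  refine tsum_congr fun i => ?_
  have hle : ρ ^ i * v < 1 := (mul_le_of_le_one_left hv0.le (pow_le_one₀ hρ0.le hρ1.le)).trans_lt hv1
  have hu : |(ρ ^ i * v) ^ 2| < 1 := by
    rw [abs_of_nonneg (by positivity)]
    exact pow_lt_one₀ (by positivity) hle two_ne_zero
  have h := (hasSum_alpha hN hk hu).mul_right ((ρ ^ i * v) ^ (N - 2))
  rw [← Finset.mul_sum, mul_comm]
  simp only [one_sub_half_eq]
  refine Eq.trans h.tsum_eq.symm (tsum_congr fun m => ?_)
  rw [pow_add, pow_mul, mul_assoc]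

/-- The closed formula for the first eigenvalue. -/
theorem pow_mul_Lambda1_eq (hN : 3 ≤ N) (hk : 1 ≤ k) {ρ r : ℝ} (hρ0 : 0 < ρ) (hρ1 : ρ < 1)
    (hr : r ∈ Ioo ρ 1) :
    r ^ (N - 2) * Lambda1 N k ρ r =
      (radialSeries N k ρ r - 2 * radialSeries N k ρ ρ + radialSeries N k ρ (ρ / r) -
        polygonConst k N) / (sphereArea N * ((N : ℝ) - 2)) := by
  have hr0 : 0 < r := hρ0.trans hr.1
  rw [pow_mul_Lambda1 hN hk hρ0 hρ1 hr]
  simp only [scaledEntry]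
  rw [Finset.sum_sub_distrib, Finset.sum_add_distrib, Finset.sum_sub_distrib, ← Finset.mul_sum,
    sum_scaleSeries hN hk hρ0 hρ1 hr0 hr.2, sum_scaleSeries hN hk hρ0 hρ1 hρ0 hρ1,
    sum_scaleSeries hN hk hρ0 hρ1 (div_pos hρ0 hr0) ((div_lt_one hr0).2 hr.1),
    sum_rpow_eq_polygonConst hN hk]
  ring

end Polygon

/-! ### Minimisation over the radius. -/

theorem exists_isLeast_image_Ioo {φ : ℝ → ℝ} {a b s : ℝ} (hs : s ∈ Ioo a b)
    (hφ : ContinuousOn φ (Ioo a b)) (ha : Tendsto φ (𝓝[>] a) atTop)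
    (hb : Tendsto φ (𝓝[<] b) atTop) : ∃ r ∈ Ioo a b, ∀ x ∈ Ioo a b, φ r ≤ φ x := by
  obtain ⟨a', ha', hA⟩ := mem_nhdsGT_iff_exists_Ioo_subset.1 (ha.eventually_ge_atTop (φ s))
  obtain ⟨b', hb', hB⟩ := mem_nhdsLT_iff_exists_Ioo_subset.1 (hb.eventually_ge_atTop (φ s))
  have hsub : Icc (min a' s) (max b' s) ⊆ Ioo a b := fun x hx =>
    ⟨(lt_min ha' hs.1).trans_le hx.1, hx.2.trans_lt (max_lt hb' hs.2)⟩
  have hsm : s ∈ Icc (min a' s) (max b' s) := ⟨min_le_right _ _, le_max_right _ _⟩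
  obtain ⟨r, hr, hmin⟩ := isCompact_Icc.exists_isMinOn ⟨s, hsm⟩ (hφ.mono hsub)
  refine ⟨r, hsub hr, fun x hx => ?_⟩
  by_cases hxa : x < min a' s
  · exact (hmin hsm).trans (hA ⟨hx.1, hxa.trans_le (min_le_left _ _)⟩)
  · by_cases hxb : max b' s < x
    · exact (hmin hsm).trans (hB ⟨(le_max_left _ _).trans_lt hxb, hx.2⟩)
    · exact hmin ⟨not_lt.1 hxa, not_lt.1 hxb⟩

section Radial

variable {N k : ℕ}

theorem hasSum_alpha_mul_pow (hN : 3 ≤ N) (hk : 1 ≤ k) {v : ℝ} (hv0 : 0 ≤ v) (hv1 : v < 1) :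
    HasSum (fun m : ℕ => alpha k m N * v ^ (2 * m + (N - 2)))
      (v ^ (N - 2) * alphaGen N k (v ^ 2)) := by
  have hv2 : v ^ 2 < 1 := pow_lt_one₀ hv0 hv1 two_ne_zero
  have h := (hasSum_alpha hN hk (u := v ^ 2)
    (by rwa [abs_of_nonneg (by positivity)])).mul_left (v ^ (N - 2))
  convert! h using 1
  ext m
  rw [pow_add, pow_mul]
  ring

theorem tendsto_pow_div_one_sub_sq (hN : 3 ≤ N) :
    Tendsto (fun v : ℝ => v ^ (N - 2) * (1 / (1 - v ^ 2) ^ (N - 2))) (𝓝[<] 1) atTop := by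
  have h1 : Tendsto (fun v : ℝ => v ^ (N - 2)) (𝓝[<] 1) (𝓝 1) := by
    have : Tendsto (fun v : ℝ => v ^ (N - 2)) (𝓝 1) (𝓝 (1 ^ (N - 2))) :=
      (continuous_pow (N - 2)).tendsto 1
    rw [one_pow] at this
    exact this.mono_left nhdsWithin_le_nhds
  have h2 : Tendsto (fun v : ℝ => (1 - v ^ 2) ^ (N - 2)) (𝓝[<] 1) (𝓝[>] 0) := by
    refine tendsto_nhdsWithin_iff.2 ⟨?_, ?_⟩
    · have : Tendsto (fun v : ℝ => (1 - v ^ 2) ^ (N - 2)) (𝓝 1) (𝓝 ((1 - 1 ^ 2) ^ (N - 2))) :=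
        Continuous.tendsto (by fun_prop) 1
      rw [one_pow, sub_self, zero_pow (by omega)] at this
      exact this.mono_left nhdsWithin_le_nhds
    · filter_upwards [Ioo_mem_nhdsLT (zero_lt_one (α := ℝ))] with v hv
      have : v ^ 2 < 1 := pow_lt_one₀ hv.1.le hv.2 two_ne_zero
      exact pow_pos (sub_pos.2 this) _
  have h3 := h2.inv_tendsto_nhdsGT_zero
  refine (h1.pos_mul_atTop one_pos h3).congr fun v => ?_
  rw [Pi.inv_apply, one_div]

/-- Replace the denominators by `1` and discard all vertices but `j = 0`. -/
theorem le_radialSeries (hN : 3 ≤ N) (hk : 1 ≤ k) {ρ v : ℝ} (hρ0 : 0 < ρ) (hρ1 : ρ < 1)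
    (hv0 : 0 ≤ v) (hv1 : v < 1) :
    v ^ (N - 2) * (1 / (1 - v ^ 2) ^ (N - 2)) ≤ radialSeries N k ρ v := by
  have hv2 : v ^ 2 < 1 := pow_lt_one₀ hv0 hv1 two_ne_zero
  refine (mul_le_mul_of_nonneg_left (one_div_le_alphaGen hN hk hv2) (by positivity)).trans ?_
  refine hasSum_le (fun m => ?_) (hasSum_alpha_mul_pow hN hk hv0 hv1)
    (summable_radialSeries hN hk hρ0 hρ1 hv0 hv1).hasSum
  have hb := one_sub_pow_bounds hN hρ0 hρ1 m
  rw [le_div_iff₀ (by linarith)]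
  exact mul_le_of_le_one_right (mul_nonneg (alpha_nonneg hN hk m) (by positivity)) hb.2

theorem radialSeries_nonneg (hN : 3 ≤ N) (hk : 1 ≤ k) {ρ v : ℝ} (hρ0 : 0 < ρ) (hρ1 : ρ < 1)
    (hv0 : 0 ≤ v) (hv1 : v < 1) : 0 ≤ radialSeries N k ρ v := by
  refine le_trans ?_ (le_radialSeries hN hk hρ0 hρ1 hv0 hv1)
  have hv2 : v ^ 2 < 1 := pow_lt_one₀ hv0 hv1 two_ne_zero
  have : 0 < 1 - v ^ 2 := by linarith
  positivity

theorem tendsto_radialSeries (hN : 3 ≤ N) (hk : 1 ≤ k) {ρ : ℝ} (hρ0 : 0 < ρ) (hρ1 : ρ < 1) :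
    Tendsto (radialSeries N k ρ) (𝓝[<] 1) atTop := by
  refine tendsto_atTop_mono' _ ?_ (tendsto_pow_div_one_sub_sq hN)
  filter_upwards [Ioo_mem_nhdsLT (zero_lt_one (α := ℝ))] with v hv
  exact le_radialSeries hN hk hρ0 hρ1 hv.1.le hv.2

theorem continuousOn_radialSeries (hN : 3 ≤ N) (hk : 1 ≤ k) {ρ : ℝ} (hρ0 : 0 < ρ) (hρ1 : ρ < 1) :
    ContinuousOn (radialSeries N k ρ) (Ioo 0 1) := by
  intro v hv
  obtain ⟨b, hvb, hb1⟩ := exists_between hv.2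
  have hb0 : 0 < b := hv.1.trans hvb
  have h : ContinuousOn (radialSeries N k ρ) (Ioo 0 b) := by
    refine continuousOn_tsum (fun m => by fun_prop)
      (summable_radialSeries hN hk hρ0 hρ1 hb0.le hb1) fun m x hx => ?_
    have hb := (one_sub_pow_bounds hN hρ0 hρ1 m).1
    have hx0 := hx.1
    have hα := alpha_nonneg hN hk m
    have hd : 0 < 1 - ρ ^ (2 * m + (N - 2)) := by linarith
    rw [Real.norm_of_nonneg (by positivity)]
    gcongr
    exact hx.2.le
  exact (h.continuousAt (Ioo_mem_nhds hv.1 hvb)).continuousWithinAt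

theorem sqrt_lt_one_of_lt_one {ρ : ℝ} (hρ1 : ρ < 1) : √ρ < 1 := by
  rw [Real.sqrt_lt' one_pos]; simpa using hρ1

/-- AM-GM in each mode: the product `r^L (ρ/r)^L = ρ^L` does not depend on `r`. -/
theorem two_mul_radialSeries_sqrt_le (hN : 3 ≤ N) (hk : 1 ≤ k) {ρ r : ℝ} (hρ0 : 0 < ρ)
    (hρ1 : ρ < 1) (hr : r ∈ Ioo ρ 1) :
    2 * radialSeries N k ρ (√ρ) ≤ radialSeries N k ρ r + radialSeries N k ρ (ρ / r) := by
  have hr0 : 0 < r := hρ0.trans hr.1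
  have hs1 := sqrt_lt_one_of_lt_one hρ1
  refine hasSum_le (fun m => ?_)
    ((summable_radialSeries hN hk hρ0 hρ1 (Real.sqrt_nonneg ρ) hs1).hasSum.mul_left 2)
    ((summable_radialSeries hN hk hρ0 hρ1 hr0.le hr.2).hasSum.add
      (summable_radialSeries hN hk hρ0 hρ1 (div_pos hρ0 hr0).le ((div_lt_one hr0).2 hr.1)).hasSum)
  have hb := (one_sub_pow_bounds hN hρ0 hρ1 m).1
  have hα := alpha_nonneg hN hk m
  set L := 2 * m + (N - 2)
  have hd : 0 < 1 - ρ ^ L := by linarith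
  have hamgm : 2 * (√ρ) ^ L ≤ r ^ L + (ρ / r) ^ L := by
    have h1 : (√ρ) ^ L * (√ρ) ^ L = r ^ L * (ρ / r) ^ L := by
      rw [← mul_pow, ← mul_pow, Real.mul_self_sqrt hρ0.le, mul_div_cancel₀ _ hr0.ne']
    have h2 : 0 ≤ r ^ L := by positivity
    have h3 : 0 ≤ (ρ / r) ^ L := by positivity
    refine le_of_sq_le_sq ?_ (by positivity)
    nlinarith [sq_nonneg (r ^ L - (ρ / r) ^ L)]
  rw [← add_div, ← mul_add, ← mul_div_assoc, mul_left_comm]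
  gcongr

/-- `ρ ^ ((2m+N-2)/2)` as a natural power of `√ρ`. -/
theorem rpow_half_eq_sqrt_pow (hN : 3 ≤ N) {ρ : ℝ} (hρ0 : 0 ≤ ρ) (m : ℕ) :
    ρ ^ ((2 * (m : ℝ) + (N : ℝ) - 2) / 2) = (√ρ) ^ (2 * m + (N - 2)) := by
  rw [Real.sqrt_eq_rpow, ← Real.rpow_natCast, ← Real.rpow_mul hρ0]
  congr 1
  rw [Nat.cast_add, Nat.cast_sub (by omega)]
  push_cast
  ring

theorem closedFormTerm_eq (hN : 3 ≤ N) {ρ : ℝ} (hρ0 : 0 ≤ ρ) (m : ℕ) :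
    closedFormTerm N k ρ m = alpha k m N *
      (2 * (√ρ) ^ (2 * m + (N - 2)) / (1 + (√ρ) ^ (2 * m + (N - 2)))) := by
  rw [closedFormTerm, rpow_half_eq_sqrt_pow hN hρ0]

/-- With `s = √ρ`, `(s^L - s^(2L))/(1 - s^(2L)) = s^L/(1 + s^L)`. -/
theorem hasSum_closedFormTerm (hN : 3 ≤ N) (hk : 1 ≤ k) {ρ : ℝ} (hρ0 : 0 < ρ) (hρ1 : ρ < 1) :
    HasSum (closedFormTerm N k ρ)
      (2 * radialSeries N k ρ (√ρ) - 2 * radialSeries N k ρ ρ) := by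
  have h := ((summable_radialSeries hN hk hρ0 hρ1 (Real.sqrt_nonneg ρ)
    (sqrt_lt_one_of_lt_one hρ1)).hasSum.mul_left 2).sub
      ((summable_radialSeries hN hk hρ0 hρ1 hρ0.le hρ1).hasSum.mul_left 2)
  convert! h using 1
  ext m
  rw [closedFormTerm_eq hN hρ0.le]
  have hb := (one_sub_pow_bounds hN hρ0 hρ1 m).1
  set L := 2 * m + (N - 2)
  have hd : 1 - ρ ^ L ≠ 0 := by linarith
  have hρs : ρ ^ L = (√ρ) ^ L * (√ρ) ^ L := by rw [← mul_pow, Real.mul_self_sqrt hρ0.le]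
  have hp : (1 : ℝ) + (√ρ) ^ L ≠ 0 := by positivity
  rw [← mul_div_assoc, ← mul_div_assoc, ← mul_div_assoc, ← sub_div, div_eq_div_iff hp hd, hρs]
  ring

theorem closedForm_eq (hN : 3 ≤ N) (hk : 1 ≤ k) {ρ : ℝ} (hρ0 : 0 < ρ) (hρ1 : ρ < 1) :
    closedForm N k ρ =
      2 * radialSeries N k ρ (√ρ) - 2 * radialSeries N k ρ ρ - polygonConst k N := by
  rw [closedForm, (hasSum_closedFormTerm hN hk hρ0 hρ1).tsum_eq]

theorem sqrt_mem_Ioo {ρ : ℝ} (hρ0 : 0 < ρ) (hρ1 : ρ < 1) : √ρ ∈ Ioo ρ 1 := by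
  refine ⟨?_, sqrt_lt_one_of_lt_one hρ1⟩
  rw [Real.lt_sqrt hρ0.le]
  nlinarith

theorem areaConst_pos (hN : 3 ≤ N) : 0 < sphereArea N * ((N : ℝ) - 2) :=
  one_div_pos.1 (greenConst_pos hN)

/-- The minimiser is `√ρ`, the fixed point of the inversion `r ↦ ρ/r`. -/
theorem isLeast_pow_mul_Lambda1 (hN : 3 ≤ N) (hk : 1 ≤ k) {ρ : ℝ} (hρ0 : 0 < ρ) (hρ1 : ρ < 1) :
    IsLeast ((fun r : ℝ => r ^ (N - 2) * Lambda1 N k ρ r) '' Ioo ρ 1)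
      (closedForm N k ρ / (sphereArea N * ((N : ℝ) - 2))) := by
  refine ⟨⟨√ρ, sqrt_mem_Ioo hρ0 hρ1, ?_⟩, ?_⟩
  · simp only
    rw [pow_mul_Lambda1_eq hN hk hρ0 hρ1 (sqrt_mem_Ioo hρ0 hρ1), closedForm_eq hN hk hρ0 hρ1,
      Real.div_sqrt]
    congr 1
    ring
  · rintro _ ⟨r, hr, rfl⟩
    simp only
    rw [pow_mul_Lambda1_eq hN hk hρ0 hρ1 hr, closedForm_eq hN hk hρ0 hρ1]
    refine div_le_div_of_nonneg_right ?_ (areaConst_pos hN).le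
    linarith [two_mul_radialSeries_sqrt_le hN hk hρ0 hρ1 hr]

/-- Coercivity: the series in `r` blows up as `r → 1`, the one in `ρ/r` as `r → ρ`, while the other
stays nonnegative and the factor `r^(2-N)` has a positive limit. -/
theorem isLeast_minLambda1 (hN : 3 ≤ N) (hk : 1 ≤ k) {ρ : ℝ} (hρ0 : 0 < ρ) (hρ1 : ρ < 1) :
    IsLeast (Lambda1 N k ρ '' Ioo ρ 1) (minLambda1 N k ρ) := by
  have hA := areaConst_pos hN
  set φ : ℝ → ℝ := fun r => (radialSeries N k ρ r - 2 * radialSeries N k ρ ρ +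
    radialSeries N k ρ (ρ / r) - polygonConst k N) * (1 / (sphereArea N * ((N : ℝ) - 2) *
      r ^ (N - 2))) with hφ
  have hΛ : ∀ r ∈ Ioo ρ 1, Lambda1 N k ρ r = φ r := fun r hr => by
    have hr0 : 0 < r := hρ0.trans hr.1
    have h := pow_mul_Lambda1_eq hN hk hρ0 hρ1 hr
    rw [eq_div_iff hA.ne'] at h
    rw [hφ]
    simp only
    rw [mul_one_div, eq_div_iff (by positivity), ← h]
    ring
  have hdiv : ∀ r ∈ Ioo ρ 1, ρ / r ∈ Ioo (0 : ℝ) 1 := fun r hr =>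
    ⟨div_pos hρ0 (hρ0.trans hr.1), (div_lt_one (hρ0.trans hr.1)).2 hr.1⟩
  have hfac : ContinuousOn (fun r : ℝ => 1 / (sphereArea N * ((N : ℝ) - 2) * r ^ (N - 2)))
      (Ioi 0) := by
    refine ContinuousOn.div (by fun_prop) (by fun_prop) fun r hr => ?_
    exact (mul_pos hA (pow_pos hr _)).ne'
  have hR := continuousOn_radialSeries hN hk hρ0 hρ1
  have hcont : ContinuousOn φ (Ioo ρ 1) := by
    refine ContinuousOn.mul ?_ (hfac.mono fun r hr => hρ0.trans hr.1)
    refine (((hR.mono fun r hr => ⟨hρ0.trans hr.1, hr.2⟩).sub continuousOn_const).add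
      (hR.comp ?_ hdiv)).sub continuousOn_const
    exact continuousOn_const.div continuousOn_id fun r hr => (hρ0.trans hr.1).ne'
  have hfactend : ∀ (l : Filter ℝ) (s : ℝ), 0 < s → l ≤ 𝓝 s →
      Tendsto (fun r : ℝ => 1 / (sphereArea N * ((N : ℝ) - 2) * r ^ (N - 2))) l
        (𝓝 (1 / (sphereArea N * ((N : ℝ) - 2) * s ^ (N - 2)))) := fun l s hs hl =>
    (hfac.continuousAt (Ioi_mem_nhds hs)).tendsto.mono_left hl
  have hone : Tendsto φ (𝓝[<] 1) atTop := by
    refine Tendsto.atTop_mul_pos (C := 1 / (sphereArea N * ((N : ℝ) - 2) * 1 ^ (N - 2)))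
      (by positivity) ?_ (hfactend _ 1 one_pos nhdsWithin_le_nhds)
    refine tendsto_atTop_mono' _ ?_ (tendsto_atTop_add_const_right _
      (-(2 * radialSeries N k ρ ρ) - polygonConst k N) (tendsto_radialSeries hN hk hρ0 hρ1))
    filter_upwards [Ioo_mem_nhdsLT hρ1] with r hr
    have := radialSeries_nonneg hN hk hρ0 hρ1 (hdiv r hr).1.le (hdiv r hr).2
    linarith
  have hrho : Tendsto φ (𝓝[>] ρ) atTop := by
    refine Tendsto.atTop_mul_pos (C := 1 / (sphereArea N * ((N : ℝ) - 2) * ρ ^ (N - 2)))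
      (by positivity) ?_ (hfactend _ ρ hρ0 nhdsWithin_le_nhds)
    have hlim : Tendsto (fun r : ℝ => ρ / r) (𝓝[>] ρ) (𝓝[<] 1) := by
      refine tendsto_nhdsWithin_iff.2 ⟨?_, ?_⟩
      · have : Tendsto (fun r : ℝ => ρ / r) (𝓝 ρ) (𝓝 (ρ / ρ)) :=
          (continuousAt_const.div continuousAt_id hρ0.ne').tendsto
        rw [div_self hρ0.ne'] at this
        exact this.mono_left nhdsWithin_le_nhds
      · filter_upwards [Ioo_mem_nhdsGT hρ1] with r hr
        exact (hdiv r hr).2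
    refine tendsto_atTop_mono' _ ?_ (tendsto_atTop_add_const_right _
      (-(2 * radialSeries N k ρ ρ) - polygonConst k N)
        ((tendsto_radialSeries hN hk hρ0 hρ1).comp hlim))
    filter_upwards [Ioo_mem_nhdsGT hρ1] with r hr
    have := radialSeries_nonneg hN hk hρ0 hρ1 (hρ0.trans hr.1).le hr.2
    simp only [Function.comp_apply]
    linarith
  obtain ⟨r, hr, hmin⟩ := exists_isLeast_image_Ioo (sqrt_mem_Ioo hρ0 hρ1) hcont hrho hone
  have hleast : IsLeast (Lambda1 N k ρ '' Ioo ρ 1) (Lambda1 N k ρ r) := by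
    refine ⟨mem_image_of_mem _ hr, ?_⟩
    rintro _ ⟨x, hx, rfl⟩
    rw [hΛ r hr, hΛ x hx]
    exact hmin x hx
  rw [minLambda1, hleast.csInf_eq]
  exact hleast

/-! ### Monotonicity, continuity and limits of the closed form. -/

/-- Since `x ↦ 2x/(1 + x)` increases, no term decreases; strictness comes from `m = 0`, where `α = k
> 0`. -/
theorem strictMonoOn_closedForm (hN : 3 ≤ N) (hk : 1 ≤ k) :
    StrictMonoOn (closedForm N k) (Ioo (0 : ℝ) 1) := by
  intro a ha b hb hab
  refine sub_lt_sub_right ?_ _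
  have hlt : ∀ m : ℕ, 2 * (√a) ^ (2 * m + (N - 2)) / (1 + (√a) ^ (2 * m + (N - 2))) <
      2 * (√b) ^ (2 * m + (N - 2)) / (1 + (√b) ^ (2 * m + (N - 2))) := fun m => by
    have hs : (√a) ^ (2 * m + (N - 2)) < (√b) ^ (2 * m + (N - 2)) :=
      pow_lt_pow_left₀ (Real.sqrt_lt_sqrt ha.1.le hab) (Real.sqrt_nonneg _) (by omega)
    have h0 : 0 ≤ (√a) ^ (2 * m + (N - 2)) := by positivity
    rw [div_lt_div_iff₀ (by linarith) (by linarith)]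
    nlinarith
  refine Summable.tsum_lt_tsum (i := 0) (fun m => ?_) ?_
    (hasSum_closedFormTerm hN hk ha.1 ha.2).summable (hasSum_closedFormTerm hN hk hb.1 hb.2).summable
  · rw [closedFormTerm_eq hN ha.1.le, closedFormTerm_eq hN hb.1.le]
    exact mul_le_mul_of_nonneg_left (hlt m).le (alpha_nonneg hN hk m)
  · rw [closedFormTerm_eq hN ha.1.le, closedFormTerm_eq hN hb.1.le]
    refine mul_lt_mul_of_pos_left (hlt 0) ?_
    rw [alpha_zero hN hk]
    exact_mod_cast hk

/-- From `x ≤ 2x/(1 + x) ≤ 2x` on `[0, 1]`. The lower bound gives divergence at `1`; both give the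
limit at `0`. -/
theorem closedFormTerm_bounds (hN : 3 ≤ N) (hk : 1 ≤ k) {ρ : ℝ} (hρ0 : 0 < ρ) (hρ1 : ρ < 1)
    (m : ℕ) : alpha k m N * (√ρ) ^ (2 * m + (N - 2)) ≤ closedFormTerm N k ρ m ∧
      closedFormTerm N k ρ m ≤ 2 * (alpha k m N * (√ρ) ^ (2 * m + (N - 2))) := by
  have hα := alpha_nonneg hN hk m
  rw [closedFormTerm_eq hN hρ0.le]
  have h0 : 0 ≤ (√ρ) ^ (2 * m + (N - 2)) := by positivity
  have h1 : (√ρ) ^ (2 * m + (N - 2)) ≤ 1 :=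
    pow_le_one₀ (Real.sqrt_nonneg _) (sqrt_lt_one_of_lt_one hρ1).le
  constructor
  · refine mul_le_mul_of_nonneg_left ?_ hα
    rw [le_div_iff₀ (by linarith)]
    nlinarith
  · rw [mul_left_comm]
    refine mul_le_mul_of_nonneg_left ?_ hα
    exact div_le_self (by linarith) (by linarith)

theorem continuousOn_closedForm (hN : 3 ≤ N) (hk : 1 ≤ k) :
    ContinuousOn (closedForm N k) (Ioo (0 : ℝ) 1) := by
  refine ContinuousOn.sub ?_ continuousOn_const
  intro v hv
  obtain ⟨b, hvb, hb1⟩ := exists_between hv.2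
  have hb0 : 0 < b := hv.1.trans hvb
  have h : ContinuousOn (fun ρ => ∑' m : ℕ, closedFormTerm N k ρ m) (Ioo 0 b) := by
    refine continuousOn_tsum (fun m => ?_) ((summable_alpha_mul_pow hN hk (Real.sqrt_nonneg b)
      (sqrt_lt_one_of_lt_one hb1)).mul_left 2) fun m x hx => ?_
    · refine ContinuousOn.congr (f := fun ρ : ℝ => alpha k m N *
        (2 * (√ρ) ^ (2 * m + (N - 2)) / (1 + (√ρ) ^ (2 * m + (N - 2))))) ?_
        fun x hx => closedFormTerm_eq hN hx.1.le m
      refine Continuous.continuousOn ?_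
      refine continuous_const.mul (Continuous.div (by fun_prop) (by fun_prop) fun x => ?_)
      positivity
    · have hα := alpha_nonneg hN hk m
      obtain ⟨h1, h2⟩ := closedFormTerm_bounds hN hk hx.1 (hx.2.trans hb1) m
      rw [Real.norm_of_nonneg (le_trans (by positivity) h1)]
      refine h2.trans ?_
      have := hx.2.le
      gcongr
  exact (h.continuousAt (Ioo_mem_nhds hv.1 hvb)).continuousWithinAt

theorem le_closedForm (hN : 3 ≤ N) (hk : 1 ≤ k) {ρ : ℝ} (hρ0 : 0 < ρ) (hρ1 : ρ < 1) :
    (√ρ) ^ (N - 2) * (1 / (1 - (√ρ) ^ 2) ^ (N - 2)) - polygonConst k N ≤ closedForm N k ρ := by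
  refine sub_le_sub_right ?_ _
  have h1 := hasSum_le (fun m => (closedFormTerm_bounds hN hk hρ0 hρ1 m).1)
    (hasSum_alpha_mul_pow hN hk (Real.sqrt_nonneg ρ) (sqrt_lt_one_of_lt_one hρ1))
    (hasSum_closedFormTerm hN hk hρ0 hρ1).summable.hasSum
  refine le_trans (mul_le_mul_of_nonneg_left (one_div_le_alphaGen hN hk ?_) (by positivity)) h1
  rwa [Real.sq_sqrt hρ0.le]

theorem closedForm_le (hN : 3 ≤ N) (hk : 1 ≤ k) {ρ : ℝ} (hρ0 : 0 < ρ) (hρ1 : ρ < 1) :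
    closedForm N k ρ ≤
      2 * ((√ρ) ^ (N - 2) * (k * (1 / (1 - ρ) ^ (N - 2)))) - polygonConst k N := by
  refine sub_le_sub_right ?_ _
  have h1 := hasSum_le (fun m => (closedFormTerm_bounds hN hk hρ0 hρ1 m).2)
    (hasSum_closedFormTerm hN hk hρ0 hρ1).summable.hasSum
    ((hasSum_alpha_mul_pow hN hk (Real.sqrt_nonneg ρ) (sqrt_lt_one_of_lt_one hρ1)).mul_left 2)
  rw [Real.sq_sqrt hρ0.le] at h1
  refine h1.trans ?_
  have := alphaGen_le (k := k) hN hρ0.le hρ1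
  gcongr

theorem tendsto_closedForm_one (hN : 3 ≤ N) (hk : 1 ≤ k) :
    Tendsto (closedForm N k) (𝓝[<] (1 : ℝ)) atTop := by
  have hs : Tendsto (fun ρ : ℝ => √ρ) (𝓝[<] 1) (𝓝[<] 1) := by
    refine tendsto_nhdsWithin_iff.2 ⟨?_, ?_⟩
    · have : Tendsto (fun ρ : ℝ => √ρ) (𝓝 1) (𝓝 (√1)) := Real.continuous_sqrt.tendsto 1
      rw [Real.sqrt_one] at this
      exact this.mono_left nhdsWithin_le_nhds
    · filter_upwards [self_mem_nhdsWithin] with ρ hρ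
      exact sqrt_lt_one_of_lt_one hρ
  refine tendsto_atTop_mono' _ ?_ (tendsto_atTop_add_const_right _ (-polygonConst k N)
    ((tendsto_pow_div_one_sub_sq hN).comp hs))
  filter_upwards [Ioo_mem_nhdsLT (zero_lt_one (α := ℝ))] with ρ hρ
  exact le_closedForm hN hk hρ.1 hρ.2

theorem tendsto_closedForm_zero (hN : 3 ≤ N) (hk : 1 ≤ k) :
    Tendsto (closedForm N k) (𝓝[>] (0 : ℝ)) (𝓝 (-polygonConst k N)) := by
  have hup : Tendsto (fun ρ : ℝ => 2 * ((√ρ) ^ (N - 2) * (k * (1 / (1 - ρ) ^ (N - 2)))) -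
      polygonConst k N) (𝓝[>] 0) (𝓝 (-polygonConst k N)) := by
    have hc : ContinuousAt (fun ρ : ℝ => 2 * ((√ρ) ^ (N - 2) * (k * (1 / (1 - ρ) ^ (N - 2)))) -
        polygonConst k N) 0 := by
      have : ContinuousAt (fun ρ : ℝ => 1 / (1 - ρ) ^ (N - 2)) 0 :=
        ContinuousAt.div (by fun_prop) (by fun_prop) (by simp)
      fun_prop
    have h := hc.tendsto
    simp only [Real.sqrt_zero, zero_pow (by omega : N - 2 ≠ 0), zero_mul, mul_zero, zero_sub] at h
    exact h.mono_left nhdsWithin_le_nhds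
  refine tendsto_of_tendsto_of_tendsto_of_le_of_le' tendsto_const_nhds hup ?_ ?_
  · filter_upwards [Ioo_mem_nhdsGT (zero_lt_one (α := ℝ))] with ρ hρ
    refine le_trans ?_ (le_closedForm hN hk hρ.1 hρ.2)
    rw [Real.sq_sqrt hρ.1.le]
    have h0 : 0 < 1 - ρ := sub_pos.2 hρ.2
    have : 0 ≤ (√ρ) ^ (N - 2) * (1 / (1 - ρ) ^ (N - 2)) := by positivity
    linarith
  · filter_upwards [Ioo_mem_nhdsGT (zero_lt_one (α := ℝ))] with ρ hρ
    exact closedForm_le hN hk hρ.1 hρ.2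

/-! ### The zero of the closed form and the sign of the minimum. -/

theorem exists_closedForm_eq_zero (hN : 3 ≤ N) (hk : 2 ≤ k) :
    ∃ ρ ∈ Ioo (0 : ℝ) 1, closedForm N k ρ = 0 := by
  have hk1 : 1 ≤ k := by omega
  obtain ⟨a, ha, ha'⟩ := (((tendsto_closedForm_zero hN hk1).eventually_lt_const
    (neg_lt_zero.2 (polygonConst_pos hk))).and
      (Ioo_mem_nhdsGT (zero_lt_one (α := ℝ)))).exists
  obtain ⟨b, hb, hb'⟩ := (((tendsto_closedForm_one hN hk1).eventually_gt_atTop 0).and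
      (Ioo_mem_nhdsLT (zero_lt_one (α := ℝ)))).exists
  exact isPreconnected_Ioo.intermediate_value ha' hb' (continuousOn_closedForm hN hk1)
    ⟨ha.le, hb.le⟩

/-- Attainment is essential here: at a minimiser of `Λ₁` the weighted value is at least the positive
weighted minimum, whereas an unattained infimum could be `0`. -/
theorem minLambda1_pos (hN : 3 ≤ N) (hk : 1 ≤ k) {ρ : ℝ} (hρ0 : 0 < ρ) (hρ1 : ρ < 1)
    (h : 0 < closedForm N k ρ) : 0 < minLambda1 N k ρ := by
  obtain ⟨r, hr, hrm⟩ := (isLeast_minLambda1 hN hk hρ0 hρ1).1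
  have h1 := (isLeast_pow_mul_Lambda1 hN hk hρ0 hρ1).2 (mem_image_of_mem _ hr)
  rw [← hrm]
  exact pos_of_mul_pos_right ((div_pos h (areaConst_pos hN)).trans_le h1)
    (pow_pos (hρ0.trans hr.1) _).le

theorem minLambda1_neg (hN : 3 ≤ N) (hk : 1 ≤ k) {ρ : ℝ} (hρ0 : 0 < ρ) (hρ1 : ρ < 1)
    (h : closedForm N k ρ < 0) : minLambda1 N k ρ < 0 := by
  obtain ⟨r, hr, hrm⟩ := (isLeast_pow_mul_Lambda1 hN hk hρ0 hρ1).1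
  have h1 := (isLeast_minLambda1 hN hk hρ0 hρ1).2 (mem_image_of_mem _ hr)
  refine h1.trans_lt (neg_of_mul_neg_right (a := r ^ (N - 2)) ?_ (pow_pos (hρ0.trans hr.1) _).le)
  simp only at hrm
  rw [hrm]
  exact div_neg_of_neg_of_pos h (areaConst_pos hN)

theorem minLambda1_eq_zero (hN : 3 ≤ N) (hk : 1 ≤ k) {ρ : ℝ} (hρ0 : 0 < ρ) (hρ1 : ρ < 1)
    (h : closedForm N k ρ = 0) : minLambda1 N k ρ = 0 := by
  apply le_antisymm
  · obtain ⟨r, hr, hrm⟩ := (isLeast_pow_mul_Lambda1 hN hk hρ0 hρ1).1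
    have h1 := (isLeast_minLambda1 hN hk hρ0 hρ1).2 (mem_image_of_mem _ hr)
    simp only [h, zero_div, mul_eq_zero] at hrm
    rcases hrm with h2 | h2
    · exact absurd h2 (pow_pos (hρ0.trans hr.1) _).ne'
    · rwa [h2] at h1
  · obtain ⟨r, hr, hrm⟩ := (isLeast_minLambda1 hN hk hρ0 hρ1).1
    have h1 := (isLeast_pow_mul_Lambda1 hN hk hρ0 hρ1).2 (mem_image_of_mem _ hr)
    rw [h, zero_div] at h1
    rw [← hrm]
    exact nonneg_of_mul_nonneg_right h1 (pow_pos (hρ0.trans hr.1) _)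

end Radial

end AnnulusGreen

end

theorem proposition4p2 (N k : ℕ) (hN : 3 ≤ N) (hk : 2 ≤ k) :
    -- the minimum of `Λ₁` over `(ρ, 1)` is attained
    (∀ ρ ∈ Ioo (0 : ℝ) 1,
      IsLeast (AnnulusGreen.Lambda1 N k ρ '' Ioo ρ 1) (AnnulusGreen.minLambda1 N k ρ)) ∧
    -- it has exactly one zero, with the stated signs on both sides of it
    (∃ ρk ∈ Ioo (0 : ℝ) 1,
      AnnulusGreen.minLambda1 N k ρk = 0 ∧
      (∀ ρ ∈ Ioo (0 : ℝ) 1, AnnulusGreen.minLambda1 N k ρ = 0 → ρ = ρk) ∧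
      (∀ ρ ∈ Ioo ρk 1, 0 < AnnulusGreen.minLambda1 N k ρ) ∧
      (∀ ρ ∈ Ioo 0 ρk, AnnulusGreen.minLambda1 N k ρ < 0)) ∧
    -- closed form of the minimum of `f(r) = r^{N-2} Λ₁(r)`
    (∀ ρ ∈ Ioo (0 : ℝ) 1,
      Summable (AnnulusGreen.closedFormTerm N k ρ) ∧
      IsLeast ((fun r : ℝ => r ^ (N - 2) * AnnulusGreen.Lambda1 N k ρ r) '' Ioo ρ 1)
        (AnnulusGreen.closedForm N k ρ / (AnnulusGreen.sphereArea N * ((N : ℝ) - 2)))) ∧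
    -- monotonicity and limits of the closed form
    StrictMonoOn (AnnulusGreen.closedForm N k) (Ioo (0 : ℝ) 1) ∧
    Tendsto (AnnulusGreen.closedForm N k) (𝓝[<] (1 : ℝ)) atTop ∧
    Tendsto (AnnulusGreen.closedForm N k) (𝓝[>] (0 : ℝ)) (𝓝 (-AnnulusGreen.polygonConst k N)) ∧
    0 < AnnulusGreen.polygonConst k N := by

  have hk1 : 1 ≤ k := by omega
  have hmono := AnnulusGreen.strictMonoOn_closedForm hN hk1
  obtain ⟨ρk, hρk, hzero⟩ := AnnulusGreen.exists_closedForm_eq_zero hN hk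
  have hpos : ∀ ρ ∈ Ioo ρk 1, 0 < AnnulusGreen.minLambda1 N k ρ := fun ρ hρ => by
    have h0 : 0 < ρ := hρk.1.trans hρ.1
    refine AnnulusGreen.minLambda1_pos hN hk1 h0 hρ.2 ?_
    rw [← hzero]
    exact hmono hρk ⟨h0, hρ.2⟩ hρ.1
  have hneg : ∀ ρ ∈ Ioo 0 ρk, AnnulusGreen.minLambda1 N k ρ < 0 := fun ρ hρ => by
    have h1 : ρ < 1 := hρ.2.trans hρk.2
    refine AnnulusGreen.minLambda1_neg hN hk1 hρ.1 h1 ?_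
    rw [← hzero]
    exact hmono ⟨hρ.1, h1⟩ hρk hρ.2
  refine ⟨fun ρ hρ => AnnulusGreen.isLeast_minLambda1 hN hk1 hρ.1 hρ.2,
    ⟨ρk, hρk, AnnulusGreen.minLambda1_eq_zero hN hk1 hρk.1 hρk.2 hzero, fun ρ hρ h => ?_,
      hpos, hneg⟩,
    fun ρ hρ => ⟨(AnnulusGreen.hasSum_closedFormTerm hN hk1 hρ.1 hρ.2).summable,
      AnnulusGreen.isLeast_pow_mul_Lambda1 hN hk1 hρ.1 hρ.2⟩,
    hmono, AnnulusGreen.tendsto_closedForm_one hN hk1, AnnulusGreen.tendsto_closedForm_zero hN hk1,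
    AnnulusGreen.polygonConst_pos hk⟩
  rcases lt_trichotomy ρ ρk with hlt | heq | hgt
  · exact absurd h (hneg ρ ⟨hρ.1, hlt⟩).ne
  · exact heq
  · exact absurd h (hpos ρ ⟨hgt, hρ.2⟩).ne'
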